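/- Let $H$ be an infinitely differentiable manifold (finite-dimensional, Hausdorff, countable at infinity), let $C^\infty(H)$ be the space of infinitely differentiable complex-valued functions on $H$ with the topology of uniform convergence, together with all derivatives, on compact subsets of $H$, and let $\mathscr D(H)$ be its dual, the space of distributions with compact support. Suppose that $H$ is an infinitely differentiable hypergroup: for each $x\in H$ there is given a linear operator $R^x$ on $C^\infty(H)$ such that for all $y\in H$ and $\varphi\in C^\infty(H)$ the function $L^y\varphi : x\mapsto (R^x\varphi)(y)$ belongs to $C^\infty(H)$; $R^xL^y=L^yR^x$ for all $x,y\in H$; there is a neutral element $e\in H$ with $R^e=I$; and $\varphi\mapsto\psi$, $\psi(x,y)=(R^y\varphi)(x)$, is a continuous map $C^\infty(H)\to C^\infty(H\times H)$. Then the following holds. The strong topology on $\mathscr D(H)$ (uniform convergence on the bounded subsets of $C^\infty(H)$) is the Mackey topology $\tau(\mathscr D(H),C^\infty(H))$, that is, the strongest locally convex topology on $\mathscr D(H)$ for which the continuous linear functionals are exactly the evaluations $f\mapsto\langle f,\varphi\rangle$ with $\varphi\in C^\infty(H)$. For every $g\in\mathscr D(H)$ the continuous linear operator $R(g)=\int R^x\,dg(x)$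 on $C^\infty(H)$ exists, i.e. for all $f\in\mathscr D(H)$ and $\varphi\in C^\infty(H)$ the function $x\mapsto\langle f,R^x\varphi\rangle$ is infinitely differentiable and $\langle f,R(g)\varphi\rangle$ is the value of $g$ on it. The generalized convolution, defined by $\langle f*g,\varphi\rangle=\langle f,R(g)\varphi\rangle$, is a bilinear operation on $\mathscr D(H)$ that makes $\mathscr D(H)$ with the above topology an associative locally convex topological algebra whose multiplication $\mathscr D(H)\times\mathscr D(H)\to\mathscr D(H)$ is jointly (not only separately) continuous. The functional $\delta_e:\varphi\mapsto\varphi(e)$ belongs to $\mathscr D(H)$, is a multiplicative functional on $C^\infty(H)$, and is a right identity: $f*\delta_e=f$ for all $f\in\mathscr D(H)$. -/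

import Mathlib

open Set Topology
open scoped Manifold ContDiff UniformConvergence

noncomputable section

section Smooth

/-- Addition and multiplication of complex numbers are smooth over `ℝ`. -/
instance instContMDiffRingComplex : ContMDiffRing 𝓘(ℝ, ℂ) ∞ ℂ :=
  { instNormedSpaceLieAddGroup with
    contMDiff_mul := by
      have h : ContMDiff 𝓘(ℝ, ℂ × ℂ) 𝓘(ℝ, ℂ) ∞ fun p : ℂ × ℂ => p.1 * p.2 :=
        contDiff_mul.contMDiff
      rwa [modelWithCornersSelf_prod, ← chartedSpaceSelf_prod] at h }

variable {E : Type*} [NormedAddCommGroup E] [NormedSpace ℝ E]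
  {H : Type*} [TopologicalSpace H] (I : ModelWithCorners ℝ E H)
  (M : Type*) [TopologicalSpace M] [ChartedSpace H M]

/-- The space `C^∞(M)` of infinitely differentiable complex-valued functions on `M`. -/
abbrev SmoothFun : Type _ := C^∞⟮I, M; 𝓘(ℝ, ℂ), ℂ⟯

variable {I M}

/-- A smooth function as an element of `C^∞(M)`. -/
def SmoothFun.mk (f : M → ℂ) (hf : ContMDiff I 𝓘(ℝ, ℂ) ∞ f) : SmoothFun I M := ⟨f, hf⟩

/-- Multiplication of smooth functions by complex constants. -/
instance SmoothFun.instSMulComplex : SMul ℂ (SmoothFun I M) where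
  smul c φ := SmoothFun.mk (fun x => c * φ x) ((contMDiff_const (c := c)).mul φ.contMDiff)

theorem SmoothFun.smul_apply (c : ℂ) (φ : SmoothFun I M) (x : M) : (c • φ) x = c * φ x := rfl

instance SmoothFun.instModuleComplex : Module ℂ (SmoothFun I M) where
  one_smul φ := by ext x; exact one_mul _
  mul_smul a b φ := by ext x; exact mul_assoc _ _ _
  smul_zero a := by ext x; exact mul_zero _
  smul_add a φ ψ := by ext x; exact mul_add _ _ _
  add_smul a b φ := by ext x; exact add_mul _ _ _
  zero_smul φ := by ext x; exact zero_mul _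

/-- The topology of uniform convergence, together with all derivatives, on compact sets: for every
chart and every order `k`, the `k`-th derivative of the function read in the chart converges
uniformly on the compact subsets of the image of the chart. -/
instance SmoothFun.instTopologicalSpace : TopologicalSpace (SmoothFun I M) :=
  ⨅ (p : M) (k : ℕ), TopologicalSpace.induced
    (fun φ : SmoothFun I M =>
      UniformOnFun.ofFun {K : Set E | IsCompact K ∧ K ⊆ (extChartAt I p).target}
        (iteratedFDerivWithin ℝ k (φ ∘ (extChartAt I p).symm) (range I)))
    inferInstance

variable (I M) in
/-- The space `𝒟(M)` of distributions with compact support: the dual of `C^∞(M)`. As a topological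
space it carries the strong topology (uniform convergence on the bounded subsets of `C^∞(M)`). -/
abbrev CompactDistribution : Type _ := StrongDual ℂ (SmoothFun I M)

end Smooth

/-- A topology on the dual `V'` of `V` is compatible with the duality between `V'` and `V` if it is
a locally convex vector space topology for which the continuous linear functionals on `V'` are
exactly the evaluations at the elements of `V`. -/
structure IsCompatibleTopology {V : Type*} [AddCommGroup V] [Module ℂ V] [TopologicalSpace V]
    (t : TopologicalSpace (StrongDual ℂ V)) : Prop where
  isTopologicalAddGroup : @IsTopologicalAddGroup (StrongDual ℂ V) t _
  continuousSMul : @ContinuousSMul ℂ (StrongDual ℂ V) _ _ t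
  locallyConvexSpace : @LocallyConvexSpace ℝ (StrongDual ℂ V) _ _ _ _ t
  continuous_iff : ∀ l : StrongDual ℂ V →ₗ[ℂ] ℂ,
    @Continuous (StrongDual ℂ V) ℂ t _ l ↔ ∃ v : V, ∀ f : StrongDual ℂ V, l f = f v

/-- `t` is the Mackey topology `τ(V', V)`, the strongest topology on `V'` compatible with the
duality between `V'` and `V`. (In the order on topologies, smaller means stronger.) -/
def IsMackeyTopology {V : Type*} [AddCommGroup V] [Module ℂ V] [TopologicalSpace V]
    (t : TopologicalSpace (StrongDual ℂ V)) : Prop :=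
  IsLeast {s : TopologicalSpace (StrongDual ℂ V) | IsCompatibleTopology s} t

section Hypergroup

variable {E : Type*} [NormedAddCommGroup E] [NormedSpace ℝ E]
  (M : Type*) [TopologicalSpace M] [ChartedSpace E M]

/-- The structure of an infinitely differentiable hypergroup on the manifold `M`: a family of linear
operators `R x` (right generalized translations) on `C^∞(M)`, with a neutral element `e`. -/
structure SmoothHypergroup where
  /-- The right translation operators. -/
  R : M → SmoothFun 𝓘(ℝ, E) M →ₗ[ℂ] SmoothFun 𝓘(ℝ, E) M
  /-- For fixed `y`, the function `x ↦ (R x φ) y` is in `C^∞(M)`. -/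
  contMDiff_left : ∀ (φ : SmoothFun 𝓘(ℝ, E) M) (y : M),
    ContMDiff 𝓘(ℝ, E) 𝓘(ℝ, ℂ) ∞ fun x : M => R x φ y
  /-- Associativity: `R x` commutes with the left translation `L y : φ ↦ (x ↦ (R x φ) y)`. -/
  assoc : ∀ (x y : M) (φ : SmoothFun 𝓘(ℝ, E) M) (t : M),
    R x (SmoothFun.mk (fun s => R s φ y) (contMDiff_left φ y)) t = R t (R x φ) y
  /-- The neutral element. -/
  e : M
  R_e : R e = LinearMap.id
  /-- The function `(x, y) ↦ (R y φ) x` is in `C^∞(M × M)`. -/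
  contMDiff_uncurry : ∀ φ : SmoothFun 𝓘(ℝ, E) M,
    ContMDiff (𝓘(ℝ, E).prod 𝓘(ℝ, E)) 𝓘(ℝ, ℂ) ∞ fun p : M × M => R p.2 φ p.1
  /-- It depends continuously on `φ`, as a map `C^∞(M) → C^∞(M × M)`. -/
  continuous_uncurry : Continuous fun φ : SmoothFun 𝓘(ℝ, E) M =>
    SmoothFun.mk (fun p : M × M => R p.2 φ p.1) (contMDiff_uncurry φ)

variable {M}

namespace SmoothHypergroup

variable (𝓗 : SmoothHypergroup (E := E) M)

/-- The continuous linear operator `A` on `C^∞(M)` is the integral `R(g) = ∫ R^x dg(x)`: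
for all `f` and `φ` the function `x ↦ ⟨f, R^x φ⟩` is smooth, and `⟨f, A φ⟩` is the value of `g`
on it. -/
def IsIntegralOperator (g : CompactDistribution 𝓘(ℝ, E) M)
    (A : SmoothFun 𝓘(ℝ, E) M →L[ℂ] SmoothFun 𝓘(ℝ, E) M) : Prop :=
  ∀ (f : CompactDistribution 𝓘(ℝ, E) M) (φ : SmoothFun 𝓘(ℝ, E) M),
    ∃ u : SmoothFun 𝓘(ℝ, E) M, (∀ x, u x = f (𝓗.R x φ)) ∧ f (A φ) = g u

/-- `conv` is the generalized convolution: `⟨f * g, φ⟩ = ⟨f, R(g) φ⟩`, the operator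
`R(g) = ∫ R^x dg(x)` existing for every `g`. -/
def IsConvolution (conv : CompactDistribution 𝓘(ℝ, E) M →ₗ[ℂ]
    CompactDistribution 𝓘(ℝ, E) M →ₗ[ℂ] CompactDistribution 𝓘(ℝ, E) M) : Prop :=
  ∀ g, ∃ A, 𝓗.IsIntegralOperator g A ∧ ∀ f φ, conv f g φ = f (A φ)

end SmoothHypergroup

end Hypergroup

end

/-!
Write `V = C^∞(M)` and `V'` for its strong dual `𝒟(M)`. The proof rests on three properties of `V`.

* It is complete and has the Heine–Borel property: on a bounded set the derivatives of each order
  are equicontinuous, since those of the next order are bounded, so by Arzelà–Ascoli every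
  ultrafilter on it converges with all derivatives (`SmoothFun.instMontelSpace`).
* It is metrizable: by the chain rule and σ-compactness, countably many charts suffice to describe
  the topology (`SmoothFun.exists_countable_withSeminorms`).
* The derivatives in the first variable, over a compact set, of a bounded set of functions on
  `M × N` form a bounded set of functions on `N` (`SmoothFun.isVonNBounded_partialDeriv`).

The first property gives the duality statements. A continuous functional on `V'` is bounded on the
polar of a bounded set, hence, by Hahn–Banach in finite dimension and compactness, it is the
evaluation at a point of a closed bounded absolutely convex set (`WithSeminorms.exists_eval_eq`).
Conversely a neighbourhood of zero in a compatible topology contains the polar of a weakly bounded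
set, and weakly bounded sets are bounded. So the strong topology is the Mackey topology.

For `ψ` smooth on `M × N` and `g` a distribution on `N`, smoothness of `x ↦ ⟨g, ψ (x, ·)⟩` is clear
if `g` is a combination of Dirac functionals. These are dense, by semireflexivity, and completeness
gives the general case (`SmoothFun.exists_chartDeriv_eq`). Applied to `ψ (x, y) = (R^y φ)(x)`, this
yields `R(g) φ`. The identity `⟨f, R(g) φ⟩ = ⟨g, u⟩` with `u x = ⟨f, R^x φ⟩` needs no Fubini
argument: `g ↦ ⟨f, R(g) φ⟩` is a continuous functional on `V'`, hence the evaluation at some smooth `u`, and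
Dirac functionals identify `u`. Associativity is the commutation of `R(h)` with the left
translations, which is the same identity for `f = δ_y ∘ R^t`.

Joint continuity comes from metrizability: for a bounded set `B`, each of countably many seminorms
of `R(g) φ`, `φ ∈ B`, is controlled by `g` on a bounded set. Countably many bounded sets of a
metrizable space can be rescaled to have a bounded union `W`, so the functions `R(g) φ` with `φ ∈ B`
and `g` in the polar of `W` form a bounded set `S`, and `f * g` lies in the polar of `B` whenever
`f` lies in the polar of `S`.
-/

/-! ### Duality for locally convex spaces -/

section Duality

open Bornology Filter

/-- A set on which every linear functional dominated by a multiple of the seminorm `p` is bounded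
is bounded for `p`: this is Banach–Steinhaus in the Banach space dual to `(V, p)`. -/
theorem Seminorm.bddAbove_image_of_forall_functional {V : Type*} [AddCommGroup V] [Module ℂ V]
    (p : Seminorm ℂ V) {P : Set V}
    (hP : ∀ l : V →ₗ[ℂ] ℂ, (∃ C, ∀ v, ‖l v‖ ≤ C * p v) → ∃ C, ∀ v ∈ P, ‖l v‖ ≤ C) :
    BddAbove (p '' P) := by
  let _ : SeminormedAddCommGroup V := p.toSeminormedAddCommGroup
  let _ : NormedSpace ℂ V := ⟨fun a b => (map_smul_eq_mul p a b).le⟩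
  obtain ⟨C, hC⟩ := banach_steinhaus
    (g := fun v : P => NormedSpace.inclusionInDoubleDual ℂ V (v : V)) (fun f => by
      obtain ⟨C, hC⟩ := hP f.toLinearMap ⟨‖f‖, fun v => f.le_opNorm v⟩
      exact ⟨C, fun v => hC v v.2⟩)
  refine ⟨C, ?_⟩
  rintro _ ⟨v, hv, rfl⟩
  obtain ⟨g, hg, hgv⟩ := exists_dual_vector'' ℂ v
  have h1 : ‖g v‖ ≤ C * 1 := by
    have := (NormedSpace.inclusionInDoubleDual ℂ V v).le_opNorm g
    have h2 := hC ⟨v, hv⟩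
    have h3 : (0 : ℝ) ≤ C := (norm_nonneg _).trans h2
    exact this.trans (mul_le_mul h2 hg (norm_nonneg _) h3)
  rw [hgv] at h1
  have : ‖((‖v‖ : ℝ) : ℂ)‖ = p v := by
    rw [Complex.norm_real, norm_norm]; rfl
  rw [mul_one] at h1
  exact this ▸ h1

/-- In a locally convex space `W` all of whose continuous functionals come from `V`, every
neighbourhood of zero contains the polar of a weakly bounded subset of `V`. -/
theorem exists_polar_subset_of_mem_nhds {V : Type*} [AddCommGroup V] [Module ℂ V]
    {W : Type*} [AddCommGroup W] [Module ℂ W] [Module ℝ W]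
    [IsScalarTower ℝ ℂ W] [TopologicalSpace W] [IsTopologicalAddGroup W] [ContinuousSMul ℂ W]
    [LocallyConvexSpace ℝ W] (ℓ : V → W →ₗ[ℂ] ℂ) (hsmul : ∀ (c : ℂ) v, ℓ (c • v) = c • ℓ v)
    (hℓ : ∀ l : W →L[ℂ] ℂ, ∃ v, ∀ w, l w = ℓ v w) {U : Set W} (hU : U ∈ 𝓝 0) :
    ∃ P : Set V, (∀ w, ∃ C, ∀ v ∈ P, ‖ℓ v w‖ ≤ C) ∧
      {w | ∀ v ∈ P, ‖ℓ v w‖ ≤ 1} ⊆ U := by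
  have : ContinuousSMul ℝ W := IsScalarTower.continuousSMul (M := ℝ) (α := W) ℂ
  obtain ⟨U', hU', hU'c, hU'U⟩ := exists_mem_nhds_isClosed_subset hU
  obtain ⟨U'', ⟨hU'', hconv⟩, hU''U'⟩ :=
    (LocallyConvexSpace.convex_basis_zero ℝ W).mem_iff.1 hU'
  -- a closed convex neighbourhood of zero inside `U`
  set C := closure U'' with hC
  have hCU : C ⊆ U := (closure_minimal hU''U' hU'c).trans hU'U
  have hC0 : C ∈ 𝓝 (0 : W) := mem_of_superset hU'' subset_closure
  refine ⟨{v | ∀ w ∈ C, (ℓ v w).re ≤ 1}, fun w => ?_, fun w hw => ?_⟩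
  · have h0 : Tendsto (fun c : ℂ => c • w) (𝓝 0) (𝓝 0) := by
      have : Continuous fun c : ℂ => c • w := by fun_prop
      simpa using this.tendsto 0
    obtain ⟨r, hr, hrC⟩ := Metric.nhds_basis_closedBall.mem_iff.1 (h0 hC0)
    refine ⟨r⁻¹, fun v hv => ?_⟩
    by_cases hz : ℓ v w = 0
    · rw [hz, norm_zero]; positivity
    -- rotate `w` so that the value of `ℓ v` becomes positive
    have hn : ‖ℓ v w‖ ≠ 0 := norm_ne_zero_iff.2 hz
    set c : ℂ := (r : ℂ) * (starRingEnd ℂ (ℓ v w) / (‖ℓ v w‖ : ℂ)) with hc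
    have hcr : c ∈ Metric.closedBall (0 : ℂ) r := by
      rw [mem_closedBall_zero_iff, hc, norm_mul, norm_div, Complex.norm_real, Complex.norm_real,
        norm_norm, RCLike.norm_conj, div_self hn, mul_one, Real.norm_of_nonneg hr.le]
    have h1 : (ℓ v (c • w)).re ≤ 1 := hv _ (hrC hcr)
    have h2 : ℓ v (c • w) = ((r * ‖ℓ v w‖ : ℝ) : ℂ) := by
      rw [map_smul, smul_eq_mul, hc, mul_assoc, div_mul_eq_mul_div, mul_comm (starRingEnd ℂ _),
        Complex.mul_conj, Complex.normSq_eq_norm_sq]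
      push_cast
      rw [pow_two, mul_div_assoc, div_self (by exact_mod_cast hn), mul_one]
    rw [h2, Complex.ofReal_re] at h1
    rwa [le_inv_comm₀ (by positivity) hr, ← one_div, le_div_iff₀ (by positivity)]
  · by_contra hwU
    obtain ⟨l, u, hlC, hlw⟩ := RCLike.geometric_hahn_banach_closed_point (𝕜 := ℂ)
      hconv.closure isClosed_closure (fun h => hwU (hCU h))
    obtain ⟨v, hv⟩ := hℓ l
    have hu : 0 < u := by
      have := hlC 0 (mem_of_mem_nhds hC0)
      simpa using this
    have key : ∀ w', ℓ (((u⁻¹ : ℝ) : ℂ) • v) w' = ((u⁻¹ : ℝ) : ℂ) * l w' := fun w' => by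
      rw [hsmul, hv]; rfl
    have hP : ∀ w' ∈ C, (ℓ (((u⁻¹ : ℝ) : ℂ) • v) w').re ≤ 1 := fun w' hw' => by
      rw [key, Complex.re_ofReal_mul, inv_mul_le_iff₀ hu, mul_one]
      exact (hlC w' hw').le
    have h1 := (Complex.re_le_norm _).trans (hw _ hP)
    rw [key, Complex.re_ofReal_mul, inv_mul_le_iff₀ hu, mul_one] at h1
    exact absurd hlw (not_lt.2 h1)

theorem IsTopologicalAddGroup.le_of_nhds_zero_le {G : Type*} [AddGroup G] {t s : TopologicalSpace G}
    (ht : @IsTopologicalAddGroup G t _) (hs : @IsTopologicalAddGroup G s _)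
    (h : @nhds G t 0 ≤ @nhds G s 0) : t ≤ s := by
  rw [le_iff_nhds]
  intro x
  have e1 : Filter.map (x + ·) (@nhds G t 0) = @nhds G t x := by
    let _ := t; exact map_add_left_nhds_zero x
  have e2 : Filter.map (x + ·) (@nhds G s 0) = @nhds G s x := by
    let _ := s; exact map_add_left_nhds_zero x
  rw [← e1, ← e2]
  exact Filter.map_mono h

variable {V : Type*} [AddCommGroup V] [Module ℂ V] [TopologicalSpace V]
  {ι : Type*} {p : SeminormFamily ℂ V ι}

/-- **Mackey's theorem**: a weakly bounded set of a locally convex space is bounded. -/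
theorem WithSeminorms.isVonNBounded_of_forall_dual (hp : WithSeminorms p) {P : Set V}
    (hP : ∀ f : StrongDual ℂ V, ∃ C, ∀ v ∈ P, ‖f v‖ ≤ C) : IsVonNBounded ℂ P := by
  rw [hp.isVonNBounded_iff_seminorm_bddAbove]
  refine fun i => (p i).bddAbove_image_of_forall_functional ?_
  rintro l ⟨C, hC⟩
  refine hP ⟨l, hp.continuous_normedSpace_rng ℂ l ⟨{i}, ⟨max C 0, le_max_right _ _⟩, fun v => ?_⟩⟩
  simp only [Finset.sup_singleton]
  exact (hC v).trans (mul_le_mul_of_nonneg_right (le_max_left _ _) (apply_nonneg _ _))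

/-- The polars of bounded sets form a basis of neighbourhoods of zero in the strong dual. -/
theorem StrongDual.hasBasis_nhds_zero_polar [ContinuousConstSMul ℂ V] :
    (𝓝 (0 : StrongDual ℂ V)).HasBasis (fun B : Set V => IsVonNBounded ℂ B)
      (fun B => {f | ∀ v ∈ B, ‖f v‖ ≤ 1}) := by
  refine (ContinuousLinearMap.hasBasis_nhds_zero_of_basis
    (Metric.nhds_basis_closedBall (x := (0 : ℂ)))).to_hasBasis ?_ ?_
  · rintro ⟨B, ε⟩ ⟨hB, hε⟩
    refine ⟨(fun v => ((ε⁻¹ : ℝ) : ℂ) • v) '' B, ?_, ?_⟩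
    · exact hB.image (((ε⁻¹ : ℝ) : ℂ) • ContinuousLinearMap.id ℂ V)
    · intro f hf v hv
      have := hf _ (mem_image_of_mem _ hv)
      simp only [map_smul, smul_eq_mul, norm_mul, Complex.norm_real, norm_inv,
        Real.norm_of_nonneg (le_of_lt hε)] at this
      rw [inv_mul_le_iff₀ hε, mul_one] at this
      simpa using this
  · intro B hB
    exact ⟨(B, 1), ⟨hB, one_pos⟩, fun f hf v hv => by simpa using hf v hv⟩

/-- Semireflexivity: on the strong dual of a locally convex space with the Heine–Borel property,
every continuous linear functional is the evaluation at a vector. -/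
theorem WithSeminorms.exists_eval_eq (hp : WithSeminorms p) [MontelSpace ℂ V]
    (F : StrongDual ℂ V →ₗ[ℂ] ℂ) (hF : Continuous F) : ∃ v : V, ∀ f, F f = f v := by
  have := hp.topologicalAddGroup
  have := hp.continuousSMul
  have hU : F ⁻¹' Metric.closedBall 0 1 ∈ 𝓝 (0 : StrongDual ℂ V) :=
    hF.continuousAt.preimage_mem_nhds (by rw [map_zero]; exact Metric.closedBall_mem_nhds _ one_pos)
  obtain ⟨B, hB, hBF⟩ := StrongDual.hasBasis_nhds_zero_polar.mem_iff.1 hU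
  choose C hC using fun i => (hp.isVonNBounded_iff_seminorm_bddAbove.1 hB i)
  -- a closed, bounded and absolutely convex set that contains `B`
  set K : Set V := {v | ∀ i, p i v ≤ max (C i) 0} with hKdef
  have hBK : B ⊆ K := fun v hv i => (hC i (mem_image_of_mem _ hv)).trans (le_max_left _ _)
  have hKcl : IsClosed K := by
    rw [hKdef, Set.ofPred_forall]
    exact isClosed_iInter fun i => isClosed_le (hp.continuous_seminorm i) continuous_const
  have hKb : IsVonNBounded ℂ K := hp.isVonNBounded_iff_seminorm_bddAbove.2 fun i =>
    ⟨max (C i) 0, by rintro _ ⟨v, hv, rfl⟩; exact hv i⟩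
  have hKc : IsCompact K := MontelSpace.isCompact_of_isClosed_of_isVonNBounded ℂ hKcl hKb
  have hK0 : (0 : V) ∈ K := fun i => by simp
  have hKs : ∀ c : ℂ, ‖c‖ ≤ 1 → ∀ v ∈ K, c • v ∈ K := fun c hc v hv i => by
    rw [map_smul_eq_mul]
    exact (mul_le_of_le_one_left (apply_nonneg _ _) hc).trans (hv i)
  -- finitely many values of `F` are attained at a point of `K`
  have hfin : ∀ s : Finset (StrongDual ℂ V), ∃ v ∈ K, ∀ f ∈ s, f v = F f := by
    classical
    intro s
    set T : V → (s → ℂ) := fun v f => (f : StrongDual ℂ V) v with hT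
    have hTc : Continuous T := continuous_pi fun f => (f : StrongDual ℂ V).continuous
    have hconv : Convex ℝ (T '' K) := by
      rintro _ ⟨v, hv, rfl⟩ _ ⟨w, hw, rfl⟩ a b ha hb hab
      refine ⟨(a : ℂ) • v + (b : ℂ) • w, fun i => ?_, ?_⟩
      · refine (map_add_le_add _ _ _).trans ?_
        rw [map_smul_eq_mul, map_smul_eq_mul, Complex.norm_real, Complex.norm_real,
          Real.norm_of_nonneg ha, Real.norm_of_nonneg hb]
        calc a * p i v + b * p i w ≤ a * max (C i) 0 + b * max (C i) 0 :=
              add_le_add (mul_le_mul_of_nonneg_left (hv i) ha) (mul_le_mul_of_nonneg_left (hw i) hb)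
          _ = max (C i) 0 := by rw [← add_mul, hab, one_mul]
      · funext f
        simp [hT]
    by_contra hcon
    have hnot : (fun f : s => F f) ∉ T '' K := by
      rintro ⟨v, hv, hvF⟩
      exact hcon ⟨v, hv, fun f hf => congrFun hvF ⟨f, hf⟩⟩
    obtain ⟨l, u, hlK, hlF⟩ := RCLike.geometric_hahn_banach_closed_point (𝕜 := ℂ) hconv
      (hKc.image hTc).isClosed hnot
    set g : StrongDual ℂ V := ∑ f : s, l (Pi.single f 1) • (f : StrongDual ℂ V) with hg
    have hl : ∀ z : s → ℂ, l z = ∑ f : s, l (Pi.single f 1) * z f := by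
      intro z
      conv_lhs => rw [pi_eq_sum_univ' z]
      rw [map_sum]
      refine Finset.sum_congr rfl fun f _ => ?_
      rw [map_smul, smul_eq_mul, mul_comm]
    have hgv : ∀ v, g v = l (T v) := fun v => by
      rw [hl, hg, sum_apply]; rfl
    have hFg : F g = l (fun f : s => F f) := by
      rw [hl, hg, map_sum]; simp
    have hu : 0 < u := by
      have h0 := hlK (T 0) (mem_image_of_mem _ hK0)
      rw [← hgv, map_zero] at h0
      simpa using h0
    have hgK : ∀ v ∈ K, ‖g v‖ ≤ u := by
      intro v hv
      by_cases hz : g v = 0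
      · rw [hz, norm_zero]; exact hu.le
      have hn : ‖g v‖ ≠ 0 := norm_ne_zero_iff.2 hz
      set c : ℂ := starRingEnd ℂ (g v) / (‖g v‖ : ℂ) with hc
      have hc1 : ‖c‖ ≤ 1 := by
        rw [hc, norm_div, Complex.norm_real, norm_norm, RCLike.norm_conj, div_self hn]
      have h1 := hlK _ (mem_image_of_mem T (hKs c hc1 v hv))
      have h2 : g (c • v) = ((‖g v‖ : ℝ) : ℂ) := by
        rw [map_smul, smul_eq_mul, hc, div_mul_eq_mul_div, mul_comm (starRingEnd ℂ _),
          Complex.mul_conj, Complex.normSq_eq_norm_sq]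
        push_cast
        rw [pow_two, mul_div_assoc, div_self (by exact_mod_cast hn), mul_one]
      rw [← hgv, h2] at h1
      exact (le_of_lt (by simpa using h1))
    have hmem : ((u⁻¹ : ℝ) : ℂ) • g ∈ F ⁻¹' Metric.closedBall 0 1 := hBF fun v hv => by
      rw [smul_apply, norm_smul, Complex.norm_real,
        Real.norm_of_nonneg (inv_nonneg.2 hu.le), inv_mul_le_iff₀ hu, mul_one]
      exact hgK v (hBK hv)
    rw [mem_preimage, mem_closedBall_zero_iff, map_smul, norm_smul, Complex.norm_real,
      Real.norm_of_nonneg (inv_nonneg.2 hu.le), inv_mul_le_iff₀ hu, mul_one, hFg] at hmem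
    exact absurd hlF (not_lt.2 ((Complex.re_le_norm _).trans hmem))
  have hne := hKc.inter_iInter_nonempty (fun f : StrongDual ℂ V => {v | f v = F f})
    (fun f => isClosed_eq f.continuous continuous_const) (fun s => by
      obtain ⟨v, hv, hvs⟩ := hfin s
      exact ⟨v, hv, mem_iInter₂.2 hvs⟩)
  obtain ⟨v, -, hv⟩ := hne
  exact ⟨v, fun f => (mem_iInter.1 hv f).symm⟩

/-- The strong topology on the dual of a locally convex space with the Heine–Borel property is the
Mackey topology. -/
theorem WithSeminorms.isMackeyTopology_strong (hp : WithSeminorms p) [MontelSpace ℂ V] :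
    IsMackeyTopology (inferInstance : TopologicalSpace (StrongDual ℂ V)) := by
  have := hp.topologicalAddGroup
  have := hp.continuousSMul
  refine ⟨⟨inferInstance, inferInstance, inferInstance, fun l => ⟨hp.exists_eval_eq l, ?_⟩⟩, ?_⟩
  · rintro ⟨v, hv⟩
    have : (l : StrongDual ℂ V → ℂ) = fun f => f v := funext hv
    rw [this]
    exact continuous_eval_const v
  · intro s hs
    refine IsTopologicalAddGroup.le_of_nhds_zero_le inferInstance hs.isTopologicalAddGroup
      fun U hU => ?_
    have h1 := hs.isTopologicalAddGroup
    have h2 := hs.continuousSMul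
    have h3 := hs.locallyConvexSpace
    let ℓ : V → StrongDual ℂ V →ₗ[ℂ] ℂ := fun v =>
      { toFun := fun f => f v, map_add' := fun _ _ => rfl, map_smul' := fun _ _ => rfl }
    obtain ⟨P, hPb, hPU⟩ := @exists_polar_subset_of_mem_nhds V _ _ (StrongDual ℂ V) _ _ _ _ s
      h1 h2 h3 ℓ (fun c v => LinearMap.ext fun f => map_smul f c v)
      (fun l => (hs.continuous_iff (@ContinuousLinearMap.toLinearMap _ _ _ _ _ _ s _ _ _ _ _ _ l)).1
        (@ContinuousLinearMap.cont _ _ _ _ _ _ s _ _ _ _ _ _ l)) U hU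
    exact mem_of_superset (StrongDual.hasBasis_nhds_zero_polar.mem_of_mem
      (hp.isVonNBounded_of_forall_dual hPb)) hPU

/-- Functionals that separate the points of a semireflexive space span a dense subspace of the
strong dual. -/
theorem WithSeminorms.dense_span_of_separating (hp : WithSeminorms p) [MontelSpace ℂ V]
    (S : Set (StrongDual ℂ V)) (hS : ∀ v : V, (∀ f ∈ S, f v = 0) → v = 0) :
    Dense (Submodule.span ℂ S : Set (StrongDual ℂ V)) := by
  by_contra hd
  obtain ⟨f, hf⟩ : ∃ f, f ∉ closure (Submodule.span ℂ S : Set (StrongDual ℂ V)) := by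
    by_contra! h
    exact hd h
  have hconv : Convex ℝ (Submodule.span ℂ S : Set (StrongDual ℂ V)) := by
    have := ((Submodule.span ℂ S).restrictScalars ℝ).convex
    exact this
  obtain ⟨l, u, hl, hlf⟩ := RCLike.geometric_hahn_banach_closed_point (𝕜 := ℂ) hconv.closure
    isClosed_closure hf
  obtain ⟨v, hv⟩ := hp.exists_eval_eq l.toLinearMap l.cont
  have hl0 : ∀ g ∈ Submodule.span ℂ S, l g = 0 := by
    intro g hg
    by_contra hne
    have h1 := hl _ (subset_closure
      ((Submodule.span ℂ S).smul_mem (((u + 1 : ℝ) : ℂ) / l g) hg))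
    rw [map_smul, smul_eq_mul, div_mul_cancel₀ _ hne] at h1
    have h2 : u + 1 < u := by simpa using h1
    linarith
  have hv0 : v = 0 := hS v fun g hg => by
    rw [← hv g]; exact hl0 g (Submodule.subset_span hg)
  have h0 := hl 0 (subset_closure (Submodule.span ℂ S).zero_mem)
  have h1 : l f = 0 := by
    have := hv f
    rw [hv0, map_zero] at this
    exact this
  rw [h1] at hlf
  simp at h0 hlf
  linarith

/-- **Mackey's countability condition**: in a metrizable locally convex space, countably many
bounded sets can be rescaled so that their union is bounded. -/
theorem WithSeminorms.exists_bounded_iUnion_smul {q : SeminormFamily ℂ V ℕ} (hq : WithSeminorms q)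
    {D : ℕ → Set V} (hD : ∀ n, IsVonNBounded ℂ (D n)) :
    ∃ c : ℕ → ℝ, (∀ n, 0 < c n) ∧ IsVonNBounded ℂ (⋃ n, (fun v => (c n : ℂ) • v) '' D n) := by
  choose b hb using fun n m => hq.isVonNBounded_iff_seminorm_bddAbove.1 (hD n) m
  set a : ℕ → ℝ := fun n => 1 + ∑ m ∈ Finset.range (n + 1), |b n m| with ha
  have ha0 : ∀ n, 0 < a n := fun n => by positivity
  refine ⟨fun n => (a n)⁻¹, fun n => inv_pos.2 (ha0 n), ?_⟩
  rw [hq.isVonNBounded_iff_seminorm_bddAbove]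
  intro m
  refine ⟨1 + ∑ n ∈ Finset.range m, |b n m|, ?_⟩
  rintro _ ⟨_, hw, rfl⟩
  obtain ⟨n, v, hv, rfl⟩ := mem_iUnion.1 hw
  have hbv : q m v ≤ |b n m| := (hb n m (mem_image_of_mem _ hv)).trans (le_abs_self _)
  change q m ((((a n)⁻¹ : ℝ) : ℂ) • v) ≤ _
  rw [map_smul_eq_mul, Complex.norm_real, Real.norm_of_nonneg (inv_nonneg.2 (ha0 n).le)]
  have hsum : ∀ s : Finset ℕ, 0 ≤ ∑ n ∈ s, |b n m| := fun s =>
    Finset.sum_nonneg fun _ _ => abs_nonneg _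
  rcases lt_or_ge n m with h | h
  · have h1 : |b n m| ≤ ∑ n ∈ Finset.range m, |b n m| :=
      Finset.single_le_sum (f := fun n => |b n m|) (fun _ _ => abs_nonneg _) (Finset.mem_range.2 h)
    have h2 : (a n)⁻¹ ≤ 1 := inv_le_one_of_one_le₀ (by
      have : 0 ≤ ∑ m ∈ Finset.range (n + 1), |b n m| := Finset.sum_nonneg fun _ _ => abs_nonneg _
      simp only [ha]; linarith)
    have h3 : (a n)⁻¹ * q m v ≤ 1 * |b n m| := mul_le_mul h2 hbv (apply_nonneg _ _) zero_le_one
    linarith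
  · have h1 : |b n m| ≤ ∑ m ∈ Finset.range (n + 1), |b n m| :=
      Finset.single_le_sum (f := fun m => |b n m|) (fun _ _ => abs_nonneg _)
        (Finset.mem_range.2 (by omega))
    have h2 : (a n)⁻¹ * q m v ≤ 1 := by
      rw [inv_mul_le_iff₀ (ha0 n), mul_one]
      simp only [ha]; linarith
    linarith [hsum (Finset.range m)]

end Duality

/-! ### Derivatives in charts and seminorms on `C^∞(M)` -/

section Seminorms

open Bornology Filter

theorem WithSeminorms.of_le_nhds_iff {𝕜 V ι : Type*} [NormedField 𝕜] [AddCommGroup V] [Module 𝕜 V]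
    {t : TopologicalSpace V} {p : SeminormFamily 𝕜 V ι}
    (h : ∀ (l : Filter V) (v : V), l ≤ @nhds V t v ↔
      ∀ i ε, 0 < ε → ∀ᶠ w in l, p i (w - v) < ε) : WithSeminorms p := by
  refine ⟨TopologicalSpace.ext_nhds fun v => ?_⟩
  have key : ∀ l : Filter V, l ≤ @nhds V t v ↔ l ≤ @nhds V p.moduleFilterBasis.topology v := by
    intro l
    rw [h, ← @tendsto_id' V l (@nhds V p.moduleFilterBasis.topology v)]
    exact (@WithSeminorms.tendsto_nhds 𝕜 V V ι _ _ _ p.moduleFilterBasis.topology p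
      (@WithSeminorms.mk _ _ _ _ _ _ p p.moduleFilterBasis.topology rfl) id l v).symm
  exact le_antisymm ((key _).1 le_rfl) ((key _).2 le_rfl)

variable {E : Type*} [NormedAddCommGroup E] [NormedSpace ℝ E]
  {H : Type*} [TopologicalSpace H] {I : ModelWithCorners ℝ E H}
  {M : Type*} [TopologicalSpace M] [ChartedSpace H M]

namespace SmoothFun

/-- The `k`-th derivative of a function on `M`, read in the preferred chart at `p`. It is meaningful
only on the target of that chart. -/
noncomputable def chartDeriv (I : ModelWithCorners ℝ E H) (p : M) (k : ℕ) (φ : M → ℂ) :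
    E → E [×k]→L[ℝ] ℂ :=
  iteratedFDeriv ℝ k (φ ∘ (extChartAt I p).symm)

variable (I M) in
/-- The indices of the seminorms defining the topology of `C^∞(M)`: a chart (given by its centre),
an order of derivation, and a compact subset of the target of the chart. -/
noncomputable def SeminormIndex : Type _ :=
  {i : M × ℕ × Set E // IsCompact i.2.2 ∧ i.2.2 ⊆ (extChartAt I i.1).target}

theorem tendsto_nhds_iff [I.Boundaryless] {α : Type*} {u : α → SmoothFun I M} {l : Filter α}
    {φ : SmoothFun I M} :
    Tendsto u l (𝓝 φ) ↔ ∀ (p : M) (k : ℕ) (K : Set E), IsCompact K → K ⊆ (extChartAt I p).target →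
      TendstoUniformlyOn (fun a => chartDeriv I p k (u a)) (chartDeriv I p k φ) l K := by
  have key : 𝓝 φ = ⨅ (p : M) (k : ℕ), comap (fun φ : SmoothFun I M =>
      UniformOnFun.ofFun {K : Set E | IsCompact K ∧ K ⊆ (extChartAt I p).target}
        (chartDeriv I p k φ)) (𝓝 (UniformOnFun.ofFun _ (chartDeriv I p k φ))) := by
    simp only [nhds_iInf, nhds_induced, chartDeriv,
      ModelWithCorners.range_eq_univ, iteratedFDerivWithin_univ]
  rw [key]
  simp only [tendsto_iInf, tendsto_comap_iff, UniformOnFun.tendsto_iff_tendstoUniformlyOn,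
    mem_ofPred_eq, and_imp]
  rfl

theorem chartDeriv_zero_apply (p : M) (φ : M → ℂ) (x : E) (v : Fin 0 → E) :
    chartDeriv I p 0 φ x v = φ ((extChartAt I p).symm x) := rfl

variable [IsManifold I ∞ M]

theorem contDiffOn_comp_symm (p : M) (φ : SmoothFun I M) :
    ContDiffOn ℝ ∞ (φ ∘ (extChartAt I p).symm) (extChartAt I p).target :=
  (φ.contMDiff.comp_contMDiffOn (contMDiffOn_extChartAt_symm p)).contDiffOn

variable [I.Boundaryless]

theorem contDiffAt_comp_symm {p : M} {x : E} (hx : x ∈ (extChartAt I p).target)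
    (φ : SmoothFun I M) : ContDiffAt ℝ ∞ (φ ∘ (extChartAt I p).symm) x :=
  (contDiffOn_comp_symm p φ).contDiffAt ((isOpen_extChartAt_target p).mem_nhds hx)

theorem chartDeriv_add {p : M} {x : E} (hx : x ∈ (extChartAt I p).target) (k : ℕ)
    (φ ψ : SmoothFun I M) :
    chartDeriv I p k (φ + ψ : SmoothFun I M) x = chartDeriv I p k φ x + chartDeriv I p k ψ x :=
  iteratedFDeriv_add_apply ((contDiffAt_comp_symm hx φ).of_le (by exact_mod_cast le_top))
    ((contDiffAt_comp_symm hx ψ).of_le (by exact_mod_cast le_top))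

theorem chartDeriv_smul {p : M} {x : E} (hx : x ∈ (extChartAt I p).target) (k : ℕ)
    (c : ℂ) (φ : SmoothFun I M) :
    chartDeriv I p k (c • φ : SmoothFun I M) x = c • chartDeriv I p k φ x :=
  iteratedFDeriv_const_smul_apply (a := c) (f := φ ∘ (extChartAt I p).symm)
    ((contDiffAt_comp_symm hx φ).of_le (by exact_mod_cast le_top))

theorem chartDeriv_sub {p : M} {x : E} (hx : x ∈ (extChartAt I p).target) (k : ℕ)
    (φ ψ : SmoothFun I M) :
    chartDeriv I p k (φ - ψ : SmoothFun I M) x = chartDeriv I p k φ x - chartDeriv I p k ψ x := by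
  rw [eq_sub_iff_add_eq, ← chartDeriv_add hx, sub_add_cancel]

theorem hasFDerivAt_chartDeriv {p : M} {x : E} (hx : x ∈ (extChartAt I p).target) (k : ℕ)
    (φ : SmoothFun I M) :
    HasFDerivAt (chartDeriv I p k φ) (chartDeriv I p (k + 1) φ x).curryLeft x := by
  have h : DifferentiableAt ℝ (chartDeriv I p k φ) x :=
    (contDiffAt_comp_symm hx φ).differentiableAt_iteratedFDeriv
      (by exact_mod_cast ENat.natCast_lt_top k)
  exact h.hasFDerivAt

theorem continuousOn_chartDeriv (p : M) (k : ℕ) (φ : SmoothFun I M) :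
    ContinuousOn (chartDeriv I p k φ) (extChartAt I p).target := fun _ hx =>
  (hasFDerivAt_chartDeriv hx k φ).continuousAt.continuousWithinAt

theorem bddAbove_range_chartDeriv (i : SeminormIndex I M) (φ : SmoothFun I M) :
    BddAbove (range fun x : i.1.2.2 => ‖chartDeriv I i.1.1 i.1.2.1 φ x‖) := by
  obtain ⟨C, hC⟩ := i.2.1.exists_bound_of_continuousOn
    ((continuousOn_chartDeriv i.1.1 i.1.2.1 φ).mono i.2.2)
  exact ⟨C, by rintro _ ⟨x, rfl⟩; exact hC x x.2⟩

/-- The supremum of the norm of the `k`-th derivative, read in a chart, over a compact set. -/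
noncomputable def chartSeminorm : SeminormFamily ℂ (SmoothFun I M) (SeminormIndex I M) := fun i =>
  Seminorm.of (fun φ => ⨆ x : i.1.2.2, ‖chartDeriv I i.1.1 i.1.2.1 φ x‖)
    (fun φ ψ => by
      refine Real.iSup_le (fun x => ?_) (add_nonneg (Real.iSup_nonneg fun _ => norm_nonneg _)
        (Real.iSup_nonneg fun _ => norm_nonneg _))
      rw [chartDeriv_add (i.2.2 x.2)]
      exact (norm_add_le _ _).trans (add_le_add (le_ciSup (bddAbove_range_chartDeriv i φ) x)
        (le_ciSup (bddAbove_range_chartDeriv i ψ) x)))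
    (fun c φ => by
      rw [Real.mul_iSup_of_nonneg (norm_nonneg c)]
      refine iSup_congr fun x => ?_
      rw [chartDeriv_smul (i.2.2 x.2), norm_smul])

theorem norm_chartDeriv_le_chartSeminorm (i : SeminormIndex I M) (φ : SmoothFun I M) {x : E}
    (hx : x ∈ i.1.2.2) : ‖chartDeriv I i.1.1 i.1.2.1 φ x‖ ≤ chartSeminorm i φ :=
  le_ciSup (bddAbove_range_chartDeriv i φ) (⟨x, hx⟩ : i.1.2.2)

theorem chartSeminorm_le {i : SeminormIndex I M} {φ : SmoothFun I M} {C : ℝ} (hC : 0 ≤ C)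
    (h : ∀ x ∈ i.1.2.2, ‖chartDeriv I i.1.1 i.1.2.1 φ x‖ ≤ C) : chartSeminorm i φ ≤ C :=
  Real.iSup_le (fun x => h x x.2) hC

variable (I M) in
theorem withSeminorms_chartSeminorm :
    WithSeminorms (chartSeminorm : SeminormFamily ℂ (SmoothFun I M) (SeminormIndex I M)) := by
  refine WithSeminorms.of_le_nhds_iff fun l φ => ?_
  have h1 := tendsto_nhds_iff (u := id) (l := l) (φ := φ)
  rw [tendsto_id'] at h1
  rw [h1]
  constructor
  · intro h i ε hε
    filter_upwards [Metric.tendstoUniformlyOn_iff.1 (h i.1.1 i.1.2.1 i.1.2.2 i.2.1 i.2.2) (ε / 2)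
      (half_pos hε)] with ψ hψ
    refine (chartSeminorm_le (half_pos hε).le fun x hx => ?_).trans_lt (half_lt_self hε)
    rw [chartDeriv_sub (i.2.2 hx), ← dist_eq_norm, dist_comm]
    exact (hψ x hx).le
  · intro h p k K hK hKp
    rw [Metric.tendstoUniformlyOn_iff]
    intro ε hε
    filter_upwards [h ⟨(p, k, K), hK, hKp⟩ ε hε] with ψ hψ x hx
    rw [dist_comm, dist_eq_norm, id, ← chartDeriv_sub (hKp hx)]
    exact (norm_chartDeriv_le_chartSeminorm ⟨(p, k, K), hK, hKp⟩ _ hx).trans_lt hψ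

instance instIsTopologicalAddGroup : IsTopologicalAddGroup (SmoothFun I M) :=
  (withSeminorms_chartSeminorm I M).topologicalAddGroup

instance instContinuousSMulComplex : ContinuousSMul ℂ (SmoothFun I M) :=
  (withSeminorms_chartSeminorm I M).continuousSMul

theorem isVonNBounded_iff {B : Set (SmoothFun I M)} :
    IsVonNBounded ℂ B ↔ ∀ (p : M) (k : ℕ) (K : Set E), IsCompact K → K ⊆ (extChartAt I p).target →
      ∃ C, ∀ φ ∈ B, ∀ x ∈ K, ‖chartDeriv I p k φ x‖ ≤ C := by
  rw [(withSeminorms_chartSeminorm I M).isVonNBounded_iff_seminorm_bddAbove]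
  constructor
  · intro h p k K hK hKp
    obtain ⟨C, hC⟩ := h ⟨(p, k, K), hK, hKp⟩
    exact ⟨C, fun φ hφ x hx => (norm_chartDeriv_le_chartSeminorm ⟨(p, k, K), hK, hKp⟩ φ hx).trans
      (hC (mem_image_of_mem _ hφ))⟩
  · intro h i
    obtain ⟨C, hC⟩ := h i.1.1 i.1.2.1 i.1.2.2 i.2.1 i.2.2
    refine ⟨max C 0, ?_⟩
    rintro _ ⟨φ, hφ, rfl⟩
    exact chartSeminorm_le (le_max_right _ _) fun x hx => (hC φ hφ x hx).trans (le_max_left _ _)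

variable (I) in
/-- The Dirac functional at `x`. -/
noncomputable def dirac (x : M) : StrongDual ℂ (SmoothFun I M) where
  toFun φ := φ x
  map_add' _ _ := rfl
  map_smul' _ _ := rfl
  cont := by
    rw [continuous_iff_continuousAt]
    intro φ
    have h := (tendsto_nhds_iff.1 (tendsto_id (x := 𝓝 φ))) x 0 {extChartAt I x x}
      isCompact_singleton (singleton_subset_iff.2 (mem_extChartAt_target x))
    have h2 := h.tendsto_at (mem_singleton _)
    have h3 : Tendsto (fun ψ : SmoothFun I M => chartDeriv I x 0 ψ (extChartAt I x x) 0) (𝓝 φ)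
        (𝓝 (chartDeriv I x 0 φ (extChartAt I x x) 0)) :=
      ((continuous_eval_const (0 : Fin 0 → E)).tendsto _).comp h2
    simp only [chartDeriv_zero_apply, extChartAt_to_inv] at h3
    exact h3

end SmoothFun

end Seminorms

/-! ### Completeness and the Heine–Borel property of `C^∞(M)` -/

section Montel

open Bornology Filter

variable {E : Type*} [NormedAddCommGroup E] [NormedSpace ℝ E] [FiniteDimensional ℝ E]
  {H : Type*} [TopologicalSpace H] {I : ModelWithCorners ℝ E H} [I.Boundaryless]
  {M : Type*} [TopologicalSpace M] [ChartedSpace H M] [IsManifold I ∞ M]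

theorem finiteDimensional_continuousMultilinearMap (k : ℕ) :
    FiniteDimensional ℝ (E [×k]→L[ℝ] ℂ) :=
  FiniteDimensional.of_injective
    (ContinuousMultilinearMap.toMultilinearMapLinear :
      (E [×k]→L[ℝ] ℂ) →ₗ[ℝ] MultilinearMap ℝ (fun _ : Fin k => E) ℂ)
    ContinuousMultilinearMap.toMultilinearMap_injective

namespace SmoothFun

/-- Locally uniform limits of all derivatives in all charts are the derivatives of a smooth limit
function. -/
theorem exists_tendsto_of_tendstoUniformlyOn {α : Type*} {l : Filter α} [l.NeBot]
    {u : α → SmoothFun I M} (h : ∀ (_ : M) (k : ℕ), E → E [×k]→L[ℝ] ℂ)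
    (hu : ∀ (p : M) (k : ℕ) (K : Set E), IsCompact K → K ⊆ (extChartAt I p).target →
      TendstoUniformlyOn (fun a => chartDeriv I p k (u a)) (h p k) l K) :
    ∃ φ, Tendsto u l (𝓝 φ) := by
  have hopen : ∀ p : M, IsOpen (extChartAt I p).target := isOpen_extChartAt_target
  have hpt : ∀ (p : M) (k : ℕ), ∀ x ∈ (extChartAt I p).target,
      Tendsto (fun a => chartDeriv I p k (u a) x) l (𝓝 (h p k x)) := fun p k x hx =>
    (hu p k {x} isCompact_singleton (singleton_subset_iff.2 hx)).tendsto_at (mem_singleton x)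
  have hloc : ∀ (p : M) (k : ℕ), TendstoLocallyUniformlyOn (fun a => chartDeriv I p k (u a))
      (h p k) l (extChartAt I p).target := fun p k =>
    (tendstoLocallyUniformlyOn_iff_forall_isCompact (hopen p)).2 fun K hKp hK => hu p k K hK hKp
  have hder : ∀ (p : M) (k : ℕ), ∀ x ∈ (extChartAt I p).target,
      HasFDerivAt (h p k) (h p (k + 1) x).curryLeft x := fun p k x hx =>
    hasFDerivAt_of_tendstoLocallyUniformlyOn (hopen p)
      (f' := fun a x => (chartDeriv I p (k + 1) (u a) x).curryLeft)
      (g' := fun x => (h p (k + 1) x).curryLeft)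
      (UniformContinuous.comp_tendstoLocallyUniformlyOn
        (continuousMultilinearCurryLeftEquiv ℝ (fun _ : Fin (k + 1) => E)
          ℂ).isometry.uniformContinuous
        (hloc p (k + 1)))
      (fun a x hx => hasFDerivAt_chartDeriv hx k (u a)) (hpt p k) hx
  have htaylor : ∀ p : M, HasFTaylorSeriesUpToOn ∞ (fun x => h p 0 x 0) (fun x k => h p k x)
      (extChartAt I p).target := fun p =>
    { zero_eq := fun x _ => rfl
      fderivWithin := fun k _ x hx => (hder p k x hx).hasFDerivWithinAt
      cont := fun k _ x hx => (hder p k x hx).continuousAt.continuousWithinAt }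
  set φ : M → ℂ := fun y => h y 0 (extChartAt I y y) 0 with hφ
  have hval : ∀ (p : M), ∀ x ∈ (extChartAt I p).target,
      Tendsto (fun a => u a ((extChartAt I p).symm x)) l (𝓝 (h p 0 x 0)) := fun p x hx =>
    ((continuous_eval_const (0 : Fin 0 → E)).tendsto _).comp (hpt p 0 x hx)
  have hφp : ∀ (p : M), ∀ x ∈ (extChartAt I p).target,
      φ ((extChartAt I p).symm x) = h p 0 x 0 := fun p x hx => by
    set y := (extChartAt I p).symm x
    have h1 := hval y (extChartAt I y y) (mem_extChartAt_target y)
    rw [extChartAt_to_inv] at h1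
    exact tendsto_nhds_unique h1 (hval p x hx)
  have hsmooth : ContMDiff I 𝓘(ℝ, ℂ) ∞ φ := fun p => by
    have h1 : ContMDiffAt I 𝓘(ℝ, ℂ) ∞ ((fun x => h p 0 x 0) ∘ extChartAt I p) p := by
      have h2 : ContDiffAt ℝ ∞ (fun x => h p 0 x 0) (extChartAt I p p) :=
        ((htaylor p).contDiffOn (n := ⊤)).contDiffAt
          ((hopen p).mem_nhds (mem_extChartAt_target p))
      exact h2.contMDiffAt.comp p contMDiffAt_extChartAt
    refine h1.congr_of_eventuallyEq ?_
    filter_upwards [extChartAt_source_mem_nhds (I := I) p] with y hy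
    rw [Function.comp_apply, ← hφp p _ ((extChartAt I p).map_source hy),
      (extChartAt I p).left_inv hy]
  refine ⟨SmoothFun.mk φ hsmooth, tendsto_nhds_iff.2 fun p k K hK hKp => ?_⟩
  refine (hu p k K hK hKp).congr_right fun x hx => ?_
  have hx' := hKp hx
  rw [(htaylor p).eq_iteratedFDerivWithin_of_uniqueDiffOn (by exact_mod_cast le_top)
    (hopen p).uniqueDiffOn hx', iteratedFDerivWithin_of_isOpen k (hopen p) hx']
  refine ((Filter.EventuallyEq.iteratedFDeriv ℝ ?_ k).eq_of_nhds).symm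
  filter_upwards [(hopen p).mem_nhds hx'] with z hz using hφp p z hz

/-- Completeness of `C^∞(M)`. -/
theorem exists_tendsto_of_uniformCauchySeqOn {α : Type*} {l : Filter α} [l.NeBot]
    {u : α → SmoothFun I M}
    (hu : ∀ (p : M) (k : ℕ) (K : Set E), IsCompact K → K ⊆ (extChartAt I p).target →
      UniformCauchySeqOn (fun a => chartDeriv I p k (u a)) l K) :
    ∃ φ, Tendsto u l (𝓝 φ) := by
  have hpt : ∀ (p : M) (k : ℕ) (x : E), ∃ y, x ∈ (extChartAt I p).target →
      Tendsto (fun a => chartDeriv I p k (u a) x) l (𝓝 y) := fun p k x => by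
    by_cases hx : x ∈ (extChartAt I p).target
    · obtain ⟨y, hy⟩ := cauchy_map_iff_exists_tendsto.1
        ((hu p k {x} isCompact_singleton (singleton_subset_iff.2 hx)).cauchy_map (mem_singleton x))
      exact ⟨y, fun _ => hy⟩
    · exact ⟨0, fun h => absurd h hx⟩
  choose h hh using hpt
  exact exists_tendsto_of_tendstoUniformlyOn h fun p k K hK hKp =>
    (hu p k K hK hKp).tendstoUniformlyOn_of_tendsto fun x hx => hh p k x (hKp hx)

/-- A bounded set of smooth functions has equicontinuous derivatives, because the next derivatives
are bounded on a ball. -/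
theorem equicontinuousAt_chartDeriv {B : Set (SmoothFun I M)} (hB : IsVonNBounded ℂ B) {p : M}
    {x : E} (hx : x ∈ (extChartAt I p).target) (k : ℕ) :
    EquicontinuousAt (fun φ : B => chartDeriv I p k (φ : SmoothFun I M)) x := by
  obtain ⟨r, hr, hrp⟩ := Metric.nhds_basis_closedBall.mem_iff.1
    ((isOpen_extChartAt_target p).mem_nhds hx)
  obtain ⟨C, hC⟩ := isVonNBounded_iff.1 hB p (k + 1) _ (isCompact_closedBall x r) hrp
  refine Metric.equicontinuousAt_of_continuity_modulus (fun y => C * ‖y - x‖) ?_ _ ?_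
  · have : Continuous fun y => C * ‖y - x‖ := by fun_prop
    simpa using this.tendsto x
  · filter_upwards [Metric.closedBall_mem_nhds x hr] with y hy φ
    rw [dist_comm, dist_eq_norm]
    refine (convex_closedBall x r).norm_image_sub_le_of_norm_hasFDerivWithin_le
      (f' := fun z => (chartDeriv I p (k + 1) (φ : SmoothFun I M) z).curryLeft)
      (fun z hz => (hasFDerivAt_chartDeriv (hrp hz) k φ.1).hasFDerivWithinAt) (fun z hz => ?_)
      (Metric.mem_closedBall_self hr.le) hy
    rw [ContinuousMultilinearMap.curryLeft_norm]
    exact hC φ.1 φ.2 z hz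

/-- The Heine–Borel property of `C^∞(M)`: by Arzelà–Ascoli every ultrafilter on a bounded set
converges together with all its derivatives. -/
instance instMontelSpace : MontelSpace ℂ (SmoothFun I M) := by
  refine ⟨fun B hBc hB => isCompact_iff_ultrafilter_le_nhds.2 fun f hf => ?_⟩
  have hBf : B ∈ (f : Filter (SmoothFun I M)) := le_principal_iff.1 hf
  have hpt : ∀ (p : M) (k : ℕ) (x : E), ∃ y, x ∈ (extChartAt I p).target →
      Tendsto (fun φ : SmoothFun I M => chartDeriv I p k φ x) f (𝓝 y) := fun p k x => by
    by_cases hx : x ∈ (extChartAt I p).target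
    · have := finiteDimensional_continuousMultilinearMap (E := E) k
      have : ProperSpace (E [×k]→L[ℝ] ℂ) := FiniteDimensional.proper ℝ _
      obtain ⟨C, hC⟩ := isVonNBounded_iff.1 hB p k {x} isCompact_singleton
        (singleton_subset_iff.2 hx)
      obtain ⟨y, -, hy⟩ := (isCompact_closedBall (0 : E [×k]→L[ℝ] ℂ) C).ultrafilter_le_nhds
        (f.map fun φ : SmoothFun I M => chartDeriv I p k φ x) (by
          rw [Ultrafilter.coe_map, le_principal_iff, mem_map]
          filter_upwards [hBf] with φ hφ
          rw [mem_preimage, mem_closedBall_zero_iff]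
          exact hC φ hφ x (mem_singleton x))
      exact ⟨y, fun _ => hy⟩
    · exact ⟨0, fun h => absurd h hx⟩
  choose h hh using hpt
  have hcomap : Tendsto ((↑) : B → SmoothFun I M)
      (comap Subtype.val (f : Filter (SmoothFun I M))) f :=
    tendsto_comap
  have hne : (comap ((↑) : B → SmoothFun I M) (f : Filter (SmoothFun I M))).NeBot :=
    comap_coe_neBot_of_le_principal hf
  obtain ⟨φ, hφ⟩ := exists_tendsto_of_tendstoUniformlyOn
    (l := comap ((↑) : B → SmoothFun I M) (f : Filter (SmoothFun I M))) (u := Subtype.val) h (by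
      intro p k K hK hKp
      have := (EquicontinuousOn.tendsto_uniformOnFun_iff_pi' (𝔖 := {K})
        (F := fun φ : B => chartDeriv I p k (φ : SmoothFun I M))
        (fun K' hK' => by rwa [mem_singleton_iff.1 hK'])
        (fun K' hK' x hx => by
          rw [mem_singleton_iff.1 hK'] at hx
          exact (equicontinuousAt_chartDeriv hB (hKp hx) k).equicontinuousWithinAt _)
        (comap ((↑) : B → SmoothFun I M) (f : Filter (SmoothFun I M))) (h p k)).2 (by
          rw [tendsto_pi_nhds]
          rintro ⟨x, hx⟩
          rw [sUnion_singleton] at hx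
          exact (hh p k x (hKp hx)).comp hcomap)
      exact UniformOnFun.tendsto_iff_tendstoUniformlyOn.1 this K (mem_singleton K))
  have hle : (f : Filter (SmoothFun I M)) ≤ 𝓝 φ := by
    have h1 : map ((↑) : B → SmoothFun I M) (comap (↑) (f : Filter (SmoothFun I M))) = f :=
      map_comap_of_mem (by rwa [Subtype.range_coe])
    rw [← h1]
    exact hφ
  exact ⟨φ, hBc.mem_of_tendsto (f := fun φ => φ) (b := (f : Filter (SmoothFun I M))) hle hBf, hle⟩

end SmoothFun

end Montel

/-! ### Metrizability of `C^∞(M)` -/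

section Metrizability

open Bornology Filter

variable {E : Type*} [NormedAddCommGroup E] [NormedSpace ℝ E]
  {H : Type*} [TopologicalSpace H] {I : ModelWithCorners ℝ E H} [I.Boundaryless]
  {M : Type*} [TopologicalSpace M] [ChartedSpace H M] [IsManifold I ∞ M]

namespace SmoothFun

/-- Change of charts: near a point of the chart at `p`, the derivatives read in the chart at `p` are
controlled by those read in the chart at `q`. -/
theorem exists_nhds_norm_chartDeriv_le (p q : M) (k : ℕ) {L : Set E}
    (hL : L ⊆ (extChartAt I q).target) {z : E} (hz : z ∈ (extChartAt I p).target)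
    (hzq : (extChartAt I p).symm z ∈ (extChartAt I q).source)
    (hzL : extChartAt I q ((extChartAt I p).symm z) ∈ interior L) :
    ∃ N ∈ 𝓝 z, ∃ C : ℝ, ∀ (φ : SmoothFun I M) (c : ℝ),
      (∀ j ≤ k, ∀ y ∈ L, ‖chartDeriv I q j φ y‖ ≤ c) → ∀ x ∈ N, ‖chartDeriv I p k φ x‖ ≤ C * c := by
  set τ : E → E := extChartAt I q ∘ (extChartAt I p).symm with hτ
  set O : Set E := (extChartAt I p).target ∩ (extChartAt I p).symm ⁻¹' (extChartAt I q).source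
  have hO : IsOpen O := (continuousOn_extChartAt_symm p).isOpen_inter_preimage
    (isOpen_extChartAt_target p) (isOpen_extChartAt_source q)
  have hτO : ContDiffOn ℝ ∞ τ O := by
    refine ContMDiffOn.contDiffOn ?_
    exact (contMDiffOn_extChartAt (I := I) (n := ∞) (x := q)).comp
      ((contMDiffOn_extChartAt_symm p).mono inter_subset_left)
      (fun x hx => by rw [mem_preimage, ← extChartAt_source I]; exact hx.2)
  set O' : Set E := O ∩ τ ⁻¹' interior L
  have hO' : IsOpen O' := hτO.continuousOn.isOpen_inter_preimage hO isOpen_interior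
  have hτO' : ContDiffOn ℝ ∞ τ O' := hτO.mono inter_subset_left
  have hzO' : z ∈ O' := ⟨⟨hz, hzq⟩, hzL⟩
  set D : ℝ := 1 + ∑ i ∈ Finset.range (k + 1), (‖iteratedFDerivWithin ℝ i τ O' z‖ + 1) with hD
  have hD1 : 1 ≤ D := le_add_of_nonneg_right (Finset.sum_nonneg fun _ _ => by positivity)
  have hbound : ∀ i ∈ Finset.range (k + 1),
      ∀ᶠ x in 𝓝 z, ‖iteratedFDerivWithin ℝ i τ O' x‖ < ‖iteratedFDerivWithin ℝ i τ O' z‖ + 1 := by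
    intro i _
    have hc : ContinuousAt (iteratedFDerivWithin ℝ i τ O') z :=
      (hτO'.continuousOn_iteratedFDerivWithin (by exact_mod_cast le_top)
        hO'.uniqueDiffOn).continuousAt (hO'.mem_nhds hzO')
    exact hc.norm.eventually_lt continuousAt_const (lt_add_one _)
  refine ⟨_, inter_mem (hO'.mem_nhds hzO') ((Finset.eventually_all _).2 hbound),
    k.factorial * D ^ k, ?_⟩
  rintro φ c hc x ⟨hxO', hx⟩
  have heq : iteratedFDeriv ℝ k (φ ∘ (extChartAt I p).symm) x =
      iteratedFDerivWithin ℝ k ((φ ∘ (extChartAt I q).symm) ∘ τ) O' x := by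
    rw [iteratedFDerivWithin_of_isOpen k hO' hxO']
    refine (Filter.EventuallyEq.iteratedFDeriv ℝ ?_ k).eq_of_nhds
    filter_upwards [hO'.mem_nhds hxO'] with y hy
    simp only [hτ, Function.comp_apply]
    rw [(extChartAt I q).left_inv hy.1.2]
  rw [chartDeriv, heq, mul_right_comm]
  refine norm_iteratedFDerivWithin_comp_le (N := ∞) (t := interior L)
    ((contDiffOn_comp_symm q φ).mono (interior_subset.trans hL)) hτO' (by exact_mod_cast le_top)
    isOpen_interior.uniqueDiffOn hO'.uniqueDiffOn (fun y hy => hy.2) hxO' (fun i hi => ?_)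
    (fun i hi1 hik => ?_)
  · rw [iteratedFDerivWithin_of_isOpen i isOpen_interior hxO'.2]
    exact hc i hi _ (interior_subset hxO'.2)
  · have hi : i ∈ Finset.range (k + 1) := Finset.mem_range.2 (by omega)
    calc ‖iteratedFDerivWithin ℝ i τ O' x‖ ≤ ‖iteratedFDerivWithin ℝ i τ O' z‖ + 1 := (hx i hi).le
      _ ≤ ∑ i ∈ Finset.range (k + 1), (‖iteratedFDerivWithin ℝ i τ O' z‖ + 1) :=
        Finset.single_le_sum (f := fun i => ‖iteratedFDerivWithin ℝ i τ O' z‖ + 1)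
          (fun _ _ => by positivity) hi
      _ ≤ D := by rw [hD]; linarith
      _ ≤ D ^ i := le_self_pow₀ hD1 (by omega)

variable (I M) in
/-- The topology of `C^∞(M)` is given by countably many of the seminorms: it suffices to take
countably many compact chart domains whose interiors cover `M`. -/
theorem exists_countable_withSeminorms [FiniteDimensional ℝ E] [SigmaCompactSpace M] [Nonempty M] :
    ∃ i : ℕ → SeminormIndex I M, WithSeminorms fun n =>
      (chartSeminorm (i n) : Seminorm ℂ (SmoothFun I M)) := by
  have hball : ∀ x : M, ∃ L : Set E, IsCompact L ∧ L ⊆ (extChartAt I x).target ∧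
      extChartAt I x x ∈ interior L := fun x => by
    obtain ⟨r, hr, hrp⟩ := Metric.nhds_basis_closedBall.mem_iff.1
      ((isOpen_extChartAt_target x).mem_nhds (mem_extChartAt_target (I := I) x))
    exact ⟨_, isCompact_closedBall _ r, hrp,
      mem_interior_iff_mem_nhds.2 (Metric.closedBall_mem_nhds _ hr)⟩
  choose L hLc hLt hLi using hball
  obtain ⟨s, hs, hcover⟩ := countable_cover_nhds_of_sigmaCompact
    (f := fun x => (extChartAt I x).source ∩ extChartAt I x ⁻¹' interior (L x)) (fun x =>
      inter_mem (extChartAt_source_mem_nhds x)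
        ((continuousAt_extChartAt x).preimage_mem_nhds (isOpen_interior.mem_nhds (hLi x))))
  have hsne : Nonempty s := by
    obtain ⟨y⟩ := ‹Nonempty M›
    have hy := hcover.symm ▸ mem_univ y
    obtain ⟨x, hx, -⟩ := mem_iUnion₂.1 hy
    exact ⟨⟨x, hx⟩⟩
  have := hs.to_subtype
  obtain ⟨e, he⟩ := exists_surjective_nat (s × ℕ)
  set i : ℕ → SeminormIndex I M := fun n => ⟨((e n).1, (e n).2, L (e n).1), hLc _, hLt _⟩ with hi
  refine ⟨i, ?_⟩
  have hw := withSeminorms_chartSeminorm I M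
  -- every seminorm is dominated by finitely many of the countable family
  have hdom : ∀ j : SeminormIndex I M, ∃ (F : Finset ℕ) (C : ℝ), 0 < C ∧
      ∀ (φ : SmoothFun I M) (c : ℝ), 0 ≤ c → (∀ n ∈ F, chartSeminorm (i n) φ ≤ c) →
        chartSeminorm j φ ≤ C * c := by
    rintro ⟨⟨p, k, K⟩, hK, hKp⟩
    have hind : ∃ (F : Finset ℕ) (C : ℝ), 0 < C ∧
        ∀ (φ : SmoothFun I M) (c : ℝ), 0 ≤ c → (∀ n ∈ F, chartSeminorm (i n) φ ≤ c) →
          ∀ x ∈ K, ‖chartDeriv I p k φ x‖ ≤ C * c := by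
      refine hK.induction_on (p := fun S => ∃ (F : Finset ℕ) (C : ℝ), 0 < C ∧
        ∀ (φ : SmoothFun I M) (c : ℝ), 0 ≤ c → (∀ n ∈ F, chartSeminorm (i n) φ ≤ c) →
          ∀ x ∈ S, ‖chartDeriv I p k φ x‖ ≤ C * c) ?_ ?_ ?_ ?_
      · exact ⟨∅, 1, one_pos, fun _ _ _ _ x hx => absurd hx (notMem_empty x)⟩
      · rintro S T hST ⟨F, C, hC, h⟩
        exact ⟨F, C, hC, fun φ c hc hF x hx => h φ c hc hF x (hST hx)⟩
      · rintro S T ⟨F, C, hC, h⟩ ⟨F', C', hC', h'⟩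
        refine ⟨F ∪ F', C + C', add_pos hC hC', fun φ c hc hF x hx => ?_⟩
        rw [add_mul]
        rcases hx with hx | hx
        · have := h φ c hc (fun n hn => hF n (Finset.mem_union_left _ hn)) x hx
          linarith [mul_nonneg hC'.le hc]
        · have := h' φ c hc (fun n hn => hF n (Finset.mem_union_right _ hn)) x hx
          linarith [mul_nonneg hC.le hc]
      · intro z hz
        have hy := hcover.symm ▸ mem_univ ((extChartAt I p).symm z)
        obtain ⟨q, hq, hzq, hzL⟩ := mem_iUnion₂.1 hy
        obtain ⟨N, hN, C, hC⟩ := exists_nhds_norm_chartDeriv_le p q k (hLt q) (hKp hz) hzq hzL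
        choose n hn using fun j : ℕ => he (⟨q, hq⟩, j)
        refine ⟨N, mem_nhdsWithin_of_mem_nhds hN, (Finset.range (k + 1)).image n, max C 1,
          lt_max_of_lt_right one_pos, fun φ c hc hF x hx => ?_⟩
        refine (hC φ c (fun j hj y hy => ?_) x hx).trans
          (mul_le_mul_of_nonneg_right (le_max_left _ _) hc)
        have h1 := hF (n j) (Finset.mem_image_of_mem _ (Finset.mem_range.2 (by omega)))
        have h2 : i (n j) = ⟨(q, j, L q), hLc q, hLt q⟩ :=
          Subtype.ext (by simp only [hi, hn])
        rw [h2] at h1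
        exact (norm_chartDeriv_le_chartSeminorm ⟨(q, j, L q), hLc q, hLt q⟩ φ hy).trans h1
    obtain ⟨F, C, hC, h⟩ := hind
    exact ⟨F, C, hC, fun φ c hc hF => chartSeminorm_le (by positivity) (h φ c hc hF)⟩
  refine WithSeminorms.of_le_nhds_iff fun l φ => ?_
  have h2 := hw.tendsto_nhds id (f := l) φ
  rw [tendsto_id'] at h2
  rw [h2]
  refine ⟨fun h n ε hε => h (i n) ε hε, fun h j ε hε => ?_⟩
  obtain ⟨F, C, hC, hF⟩ := hdom j
  filter_upwards [(Finset.eventually_all F).2 fun n _ => h n (ε / (2 * C)) (by positivity)]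
    with ψ hψ
  have := hF (ψ - φ) (ε / (2 * C)) (by positivity) fun n hn => (hψ n hn).le
  calc chartSeminorm j (ψ - φ) ≤ C * (ε / (2 * C)) := this
    _ = ε / 2 := by field_simp
    _ < ε := half_lt_self hε

end SmoothFun

end Metrizability

/-! ### Derivatives in the first variable -/

section PartialDerivatives

open Bornology Filter

section Calculus

variable {E F G : Type*} [NormedAddCommGroup E] [NormedSpace ℝ E] [NormedAddCommGroup F]
  [NormedSpace ℝ F] [NormedAddCommGroup G] [NormedSpace ℝ G]

theorem norm_iteratedFDeriv_iteratedFDeriv (f : E → F) (k l : ℕ) (x : E) :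
    ‖iteratedFDeriv ℝ l (iteratedFDeriv ℝ k f) x‖ = ‖iteratedFDeriv ℝ (l + k) f x‖ := by
  induction l generalizing k with
  | zero => rw [norm_iteratedFDeriv_zero, zero_add]
  | succ l ih =>
    have h := LinearIsometryEquiv.norm_iteratedFDeriv_comp_left (𝕜 := ℝ)
      (F := E [×(k + 1)]→L[ℝ] F) (G := E →L[ℝ] E [×k]→L[ℝ] F)
      (continuousMultilinearCurryLeftEquiv ℝ (fun _ : Fin (k + 1) => E) F)
      (iteratedFDeriv ℝ (k + 1) f) x l
    rw [← norm_iteratedFDeriv_fderiv, fderiv_iteratedFDeriv, add_assoc, add_comm 1 k, ← ih]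
    exact h

/-- The iterated derivatives of a function restricted to an affine subspace. -/
theorem ContinuousLinearMap.iteratedFDeriv_comp_add {f : E → F} {S : Set E} (hS : IsOpen S)
    (hf : ContDiffOn ℝ ∞ f S) (g : G →L[ℝ] E) (a : E) {x : G} (hx : g x + a ∈ S) (k : ℕ) :
    iteratedFDeriv ℝ k (fun z => f (g z + a)) x =
      (iteratedFDeriv ℝ k f (g x + a)).compContinuousLinearMap fun _ => g := by
  have hc : Continuous fun u : E => u + a := by fun_prop
  set S' : Set E := (fun u => u + a) ⁻¹' S
  have hS' : IsOpen S' := hS.preimage hc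
  have hf' : ContDiffOn ℝ ∞ (fun u => f (u + a)) S' :=
    hf.comp (by fun_prop) fun _ hu => hu
  have hS'' : IsOpen (g ⁻¹' S') := hS'.preimage g.continuous
  have h := g.iteratedFDerivWithin_comp_right hf' hS'.uniqueDiffOn hS''.uniqueDiffOn (x := x) hx
    (i := k) (by exact_mod_cast le_top)
  rw [iteratedFDerivWithin_of_isOpen k hS'' hx, iteratedFDerivWithin_of_isOpen k hS' hx,
    iteratedFDeriv_comp_add_right] at h
  exact h

theorem ContDiffOn.iteratedFDeriv_of_isOpen {f : E → F} {S : Set E} (hS : IsOpen S)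
    (hf : ContDiffOn ℝ ∞ f S) (k : ℕ) : ContDiffOn ℝ ∞ (iteratedFDeriv ℝ k f) S := fun _ hx =>
  ((hf.contDiffAt (hS.mem_nhds hx)).iteratedFDeriv_right (m := ∞) (i := k)
    (by exact_mod_cast le_top)).contDiffWithinAt

theorem iteratedFDeriv_prodMk_left {f : E × F → G} {S : Set (E × F)} (hS : IsOpen S)
    (hf : ContDiffOn ℝ ∞ f S) {x : E} {w : F} (hx : (x, w) ∈ S) (k : ℕ) (v : Fin k → E) :
    iteratedFDeriv ℝ k (fun z => f (z, w)) x v =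
      iteratedFDeriv ℝ k f (x, w) fun i => (v i, 0) := by
  have h := ContinuousLinearMap.iteratedFDeriv_comp_add hS hf (ContinuousLinearMap.inl ℝ E F)
    (0, w) (x := x) (by simpa using hx) k
  simp only [ContinuousLinearMap.inl_apply, Prod.mk_add_mk, add_zero, zero_add] at h
  rw [h]
  rfl

/-- The derivatives in the second variable of a derivative in the first variable are controlled by
the derivatives of the function of two variables. -/
theorem norm_iteratedFDeriv_partial_le {f : E × F → G} {S : Set (E × F)} (hS : IsOpen S)
    (hf : ContDiffOn ℝ ∞ f S) {x : E} {w : F} (hx : (x, w) ∈ S) (k l : ℕ) (v : Fin k → E) :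
    ‖iteratedFDeriv ℝ l (fun z => iteratedFDeriv ℝ k f (x, z) fun i => (v i, 0)) w‖ ≤
      ‖iteratedFDeriv ℝ (l + k) f (x, w)‖ * ∏ i, ‖v i‖ := by
  set ev := ContinuousMultilinearMap.apply ℝ (fun _ : Fin k => E × F) G fun i => (v i, 0) with hev
  have hfk := hf.iteratedFDeriv_of_isOpen hS k
  have hevn : ‖ev‖ ≤ ∏ i, ‖v i‖ := by
    refine ContinuousLinearMap.opNorm_le_bound _ (Finset.prod_nonneg fun _ _ => norm_nonneg _)
      fun c => ?_
    rw [mul_comm]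
    refine (c.le_opNorm _).trans (le_of_eq ?_)
    simp [Prod.norm_def]
  have h := ContinuousLinearMap.iteratedFDeriv_comp_add hS (f := ev ∘ iteratedFDeriv ℝ k f)
    (ev.contDiff.comp_contDiffOn hfk) (ContinuousLinearMap.inr ℝ E F)
    (x, 0) (x := w) (by simpa using hx) l
  simp only [ContinuousLinearMap.inr_apply, Prod.mk_add_mk, add_zero, zero_add] at h
  change ‖iteratedFDeriv ℝ l (fun z => (ev ∘ iteratedFDeriv ℝ k f) (x, z)) w‖ ≤ _
  rw [h, ev.iteratedFDeriv_comp_left (hfk.contDiffAt (hS.mem_nhds hx)) (by exact_mod_cast le_top)]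
  refine (ContinuousMultilinearMap.norm_compContinuousLinearMap_le _ _).trans ?_
  have h1 : ∏ _i : Fin l, ‖ContinuousLinearMap.inr ℝ E F‖ ≤ 1 :=
    Finset.prod_le_one (fun _ _ => norm_nonneg _) fun _ _ => ContinuousLinearMap.norm_inr_le_one ..
  refine (mul_le_of_le_one_right (norm_nonneg _) h1).trans ?_
  refine (ContinuousLinearMap.norm_compContinuousMultilinearMap_le _ _).trans ?_
  rw [norm_iteratedFDeriv_iteratedFDeriv, mul_comm]
  exact mul_le_mul_of_nonneg_left hevn (norm_nonneg _)

end Calculus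

variable {E : Type*} [NormedAddCommGroup E] [NormedSpace ℝ E]
  {H : Type*} [TopologicalSpace H] {I : ModelWithCorners ℝ E H}
  {M : Type*} [TopologicalSpace M] [ChartedSpace H M]
  {F : Type*} [NormedAddCommGroup F] [NormedSpace ℝ F]
  {H' : Type*} [TopologicalSpace H'] {J : ModelWithCorners ℝ F H'}
  {N : Type*} [TopologicalSpace N] [ChartedSpace H' N]

namespace SmoothFun

theorem mem_target_prod {p : M} {q : N} {x : E} {w : F} (hx : x ∈ (extChartAt I p).target)
    (hw : w ∈ (extChartAt J q).target) : (x, w) ∈ (extChartAt (I.prod J) (p, q)).target := by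
  rw [extChartAt_prod]
  exact ⟨hx, hw⟩

variable [I.Boundaryless] [IsManifold I ∞ M] [J.Boundaryless] [IsManifold J ∞ N]

/-- The derivative in the first variable, read in the product chart at `(p, q)`. -/
theorem chartDeriv_left_apply (ψ : SmoothFun (I.prod J) (M × N)) {p : M} {x : E}
    (hx : x ∈ (extChartAt I p).target) (k : ℕ) (v : Fin k → E) {q : N} {w : F}
    (hw : w ∈ (extChartAt J q).target) :
    chartDeriv I p k (fun z => ψ (z, (extChartAt J q).symm w)) x v =
      chartDeriv (I.prod J) (p, q) k ψ (x, w) fun i => (v i, 0) := by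
  have h := iteratedFDeriv_prodMk_left (isOpen_extChartAt_target (I := I.prod J) (p, q))
    (contDiffOn_comp_symm (p, q) ψ) (mem_target_prod hx hw) k v
  rw [chartDeriv, chartDeriv, ← h]
  simp only [extChartAt_prod]
  rfl

theorem contMDiff_chartDeriv_left (ψ : SmoothFun (I.prod J) (M × N)) {p : M} {x : E}
    (hx : x ∈ (extChartAt I p).target) (k : ℕ) (v : Fin k → E) :
    ContMDiff J 𝓘(ℝ, ℂ) ∞ fun y : N => chartDeriv I p k (fun z => ψ (z, y)) x v := by
  intro q
  have hS := isOpen_extChartAt_target (I := I.prod J) (p, q)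
  have h1 : ContDiffAt ℝ ∞ (fun w => chartDeriv (I.prod J) (p, q) k ψ (x, w) fun i => (v i, 0))
      (extChartAt J q q) := by
    have h2 := ((contDiffOn_comp_symm (p, q) ψ).iteratedFDeriv_of_isOpen hS k).contDiffAt
      (hS.mem_nhds (mem_target_prod hx (mem_extChartAt_target q)))
    have h3 : ContDiffAt ℝ ∞ (fun w : F => (x, w)) (extChartAt J q q) := by fun_prop
    exact (ContinuousMultilinearMap.apply ℝ (fun _ : Fin k => E × F) ℂ
      fun i => (v i, 0)).contDiff.contDiffAt.comp _ (h2.comp _ h3)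
  refine (h1.contMDiffAt.comp q contMDiffAt_extChartAt).congr_of_eventuallyEq ?_
  filter_upwards [extChartAt_source_mem_nhds (I := J) q] with y hy
  rw [Function.comp_apply, ← chartDeriv_left_apply ψ hx k v ((extChartAt J q).map_source hy),
    (extChartAt J q).left_inv hy]

/-- The derivative of order `k` in the first variable of a smooth function of two variables, at the
point with coordinate `x` in the chart at `p`, as a smooth function of the second variable. -/
noncomputable def partialDeriv (ψ : SmoothFun (I.prod J) (M × N)) {p : M} {x : E}
    (hx : x ∈ (extChartAt I p).target) (k : ℕ) (v : Fin k → E) : SmoothFun J N :=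
  SmoothFun.mk _ (contMDiff_chartDeriv_left ψ hx k v)

theorem norm_chartDeriv_partialDeriv_le (ψ : SmoothFun (I.prod J) (M × N)) {p : M} {x : E}
    (hx : x ∈ (extChartAt I p).target) (k : ℕ) (v : Fin k → E) (q : N) (l : ℕ) {w : F}
    (hw : w ∈ (extChartAt J q).target) :
    ‖chartDeriv J q l (partialDeriv ψ hx k v) w‖ ≤
      ‖chartDeriv (I.prod J) (p, q) (l + k) ψ (x, w)‖ * ∏ i, ‖v i‖ := by
  refine le_of_eq_of_le ?_ (norm_iteratedFDeriv_partial_le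
    (isOpen_extChartAt_target (I := I.prod J) (p, q)) (contDiffOn_comp_symm (p, q) ψ)
    (mem_target_prod hx hw) k l v)
  congr 1
  refine (Filter.EventuallyEq.iteratedFDeriv ℝ ?_ l).eq_of_nhds
  filter_upwards [(isOpen_extChartAt_target q).mem_nhds hw] with z hz
  exact chartDeriv_left_apply ψ hx k v hz

/-- For `ψ` in a bounded set, the derivatives in the first variable over a compact set form a
bounded set of functions of the second variable. -/
theorem isVonNBounded_partialDeriv {B : Set (SmoothFun (I.prod J) (M × N))}
    (hB : IsVonNBounded ℂ B) (i : SeminormIndex I M) :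
    IsVonNBounded ℂ {φ : SmoothFun J N | ∃ ψ ∈ B, ∃ (x : E) (hx : x ∈ i.1.2.2)
      (v : Fin i.1.2.1 → E), (∀ j, ‖v j‖ ≤ 1) ∧ φ = partialDeriv ψ (i.2.2 hx) i.1.2.1 v} := by
  rw [isVonNBounded_iff]
  intro q l L hL hLq
  obtain ⟨C, hC⟩ := isVonNBounded_iff.1 hB (i.1.1, q) (l + i.1.2.1) (i.1.2.2 ×ˢ L)
    (i.2.1.prod hL) (fun z hz => mem_target_prod (i.2.2 hz.1) (hLq hz.2))
  refine ⟨C, ?_⟩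
  rintro _ ⟨ψ, hψ, x, hx, v, hv, rfl⟩ w hw
  refine (norm_chartDeriv_partialDeriv_le ψ (i.2.2 hx) _ v q l (hLq hw)).trans ?_
  refine (mul_le_of_le_one_right (norm_nonneg _) ?_).trans (hC ψ hψ (x, w) ⟨hx, hw⟩)
  exact Finset.prod_le_one (fun _ _ => norm_nonneg _) fun j _ => hv j

end SmoothFun

end PartialDerivatives

/-! ### Distributions acting on the second variable -/

section Pairing

open Bornology Filter

theorem ContinuousMultilinearMap.norm_le_of_forall_norm_le_one {E F : Type*}
    [NormedAddCommGroup E] [NormedSpace ℝ E] [NormedAddCommGroup F] [NormedSpace ℝ F] {k : ℕ}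
    {m : E [×k]→L[ℝ] F} {C : ℝ} (hC : 0 ≤ C)
    (h : ∀ v : Fin k → E, (∀ j, ‖v j‖ ≤ 1) → ‖m v‖ ≤ C) : ‖m‖ ≤ C := by
  refine ContinuousMultilinearMap.opNorm_le_bound hC fun v => ?_
  by_cases hv : ∃ j, v j = 0
  · obtain ⟨j, hj⟩ := hv
    rw [m.map_coord_zero j hj, norm_zero]
    positivity
  · push Not at hv
    have hn : ∀ j, ‖v j‖ ≠ 0 := fun j => norm_ne_zero_iff.2 (hv j)
    have h1 : v = fun j => ‖v j‖ • (‖v j‖⁻¹ • v j) := by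
      funext j
      rw [smul_smul, mul_inv_cancel₀ (hn j), one_smul]
    rw [h1, m.map_smul_univ, norm_smul, mul_comm, ← h1]
    refine mul_le_mul (h _ fun j => ?_) (le_of_eq ?_) (norm_nonneg _) hC
    · rw [norm_smul, norm_inv, norm_norm, inv_mul_cancel₀ (hn j)]
    · rw [Real.norm_of_nonneg (Finset.prod_nonneg fun _ _ => norm_nonneg _)]

theorem StrongDual.exists_norm_le_of_isVonNBounded {V : Type*} [AddCommGroup V] [Module ℂ V]
    [TopologicalSpace V] (f : StrongDual ℂ V) {D : Set V} (hD : IsVonNBounded ℂ D) :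
    ∃ C, 0 ≤ C ∧ ∀ d ∈ D, ‖f d‖ ≤ C := by
  obtain ⟨C, hC⟩ := isBounded_iff_forall_norm_le.1
    (NormedSpace.isVonNBounded_iff ℂ |>.1 (hD.image f))
  exact ⟨max C 0, le_max_right _ _, fun d hd => (hC _ (mem_image_of_mem _ hd)).trans
    (le_max_left _ _)⟩

theorem StrongDual.eventually_norm_sub_le {V : Type*} [AddCommGroup V] [Module ℂ V]
    [TopologicalSpace V] (f : StrongDual ℂ V) {D : Set V} (hD : IsVonNBounded ℂ D) {ε : ℝ}
    (hε : 0 < ε) : ∀ᶠ g in 𝓝 f, ∀ d ∈ D, ‖g d - f d‖ ≤ ε := by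
  have h1 : Tendsto (fun g : StrongDual ℂ V => g - f) (𝓝 f) (𝓝 0) := by
    have : Continuous fun g : StrongDual ℂ V => g - f := continuous_id.sub continuous_const
    simpa using this.tendsto f
  have h2 := h1.eventually (ContinuousLinearMap.eventually_nhds_zero_mapsTo hD
    (Metric.closedBall_mem_nhds (0 : ℂ) hε))
  filter_upwards [h2] with g hg d hd
  simpa using hg hd

variable {E : Type*} [NormedAddCommGroup E] [NormedSpace ℝ E]
  {H : Type*} [TopologicalSpace H] {I : ModelWithCorners ℝ E H}
  {M : Type*} [TopologicalSpace M] [ChartedSpace H M]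
  {F : Type*} [NormedAddCommGroup F] [NormedSpace ℝ F]
  {H' : Type*} [TopologicalSpace H'] {J : ModelWithCorners ℝ F H'}
  {N : Type*} [TopologicalSpace N] [ChartedSpace H' N]

namespace SmoothFun

theorem contMDiff_prodMk (ψ : SmoothFun (I.prod J) (M × N)) (x : M) :
    ContMDiff J 𝓘(ℝ, ℂ) ∞ fun y => ψ (x, y) :=
  ψ.contMDiff.comp (contMDiff_const.prodMk contMDiff_id)

variable [I.Boundaryless] [IsManifold I ∞ M] [J.Boundaryless] [IsManifold J ∞ N]

/-- The Dirac functionals span a dense subspace of the space of compactly supported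
distributions. -/
theorem dense_span_dirac [FiniteDimensional ℝ F] :
    Dense (Submodule.span ℂ (range (dirac J : N → _)) : Set (CompactDistribution J N)) :=
  (withSeminorms_chartSeminorm J N).dense_span_of_separating _ fun φ hφ => by
    ext y
    exact hφ _ (mem_range_self y)

/-- Finite combinations of Dirac functionals can be applied to the second variable. -/
theorem exists_chartDeriv_eq_of_mem_span (ψ : SmoothFun (I.prod J) (M × N))
    {g : CompactDistribution J N} (hg : g ∈ Submodule.span ℂ (range (dirac J : N → _))) :
    ∃ φ : SmoothFun I M, ∀ (p : M) (x : E) (hx : x ∈ (extChartAt I p).target) (k : ℕ)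
      (v : Fin k → E), chartDeriv I p k φ x v = g (partialDeriv ψ hx k v) := by
  induction hg using Submodule.span_induction with
  | mem g hg =>
    obtain ⟨y, rfl⟩ := hg
    exact ⟨SmoothFun.mk (fun z => ψ (z, y))
      (ψ.contMDiff.comp (contMDiff_id.prodMk contMDiff_const)), fun p x hx k v => rfl⟩
  | zero =>
    refine ⟨0, fun p x hx k v => ?_⟩
    have h := chartDeriv_sub hx k (0 : SmoothFun I M) 0
    rw [sub_self, sub_self] at h
    rw [h]
    rfl
  | add g g' _ _ h h' =>
    obtain ⟨φ, hφ⟩ := h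
    obtain ⟨φ', hφ'⟩ := h'
    refine ⟨φ + φ', fun p x hx k v => ?_⟩
    rw [chartDeriv_add hx, add_apply, hφ p x hx, hφ' p x hx]
    rfl
  | smul c g _ h =>
    obtain ⟨φ, hφ⟩ := h
    refine ⟨c • φ, fun p x hx k v => ?_⟩
    rw [chartDeriv_smul hx, _root_.smul_apply, hφ p x hx]
    rfl

variable [FiniteDimensional ℝ E] [FiniteDimensional ℝ F]

/-- Applying a compactly supported distribution to the second variable of a smooth function gives a
smooth function of the first variable, and commutes with the derivatives in that variable. The
distribution is approximated by combinations of Dirac functionals. -/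
theorem exists_chartDeriv_eq (ψ : SmoothFun (I.prod J) (M × N)) (g : CompactDistribution J N) :
    ∃ φ : SmoothFun I M, ∀ (p : M) (x : E) (hx : x ∈ (extChartAt I p).target) (k : ℕ)
      (v : Fin k → E), chartDeriv I p k φ x v = g (partialDeriv ψ hx k v) := by
  set S := Submodule.span ℂ (range (dirac J : N → CompactDistribution J N))
  choose u hu using fun g' : S => exists_chartDeriv_eq_of_mem_span ψ g'.2
  set l : Filter S := comap ((↑) : S → CompactDistribution J N) (𝓝 g) with hl
  have hne : l.NeBot := mem_closure_iff_comap_neBot.1 (dense_span_dirac g)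
  have hlg : Tendsto ((↑) : S → CompactDistribution J N) l (𝓝 g) := tendsto_comap
  obtain ⟨φ, hφ⟩ := exists_tendsto_of_uniformCauchySeqOn (l := l) (u := u) (by
    intro p k K hK hKp U hU
    obtain ⟨ε, hε, hεU⟩ := Metric.mem_uniformity_dist.1 hU
    have hD := isVonNBounded_partialDeriv
      (isVonNBounded_singleton (𝕜 := ℂ) (x := ψ)) ⟨(p, k, K), hK, hKp⟩
    have hev := hlg.eventually (StrongDual.eventually_norm_sub_le g hD
      (show 0 < ε / 3 by positivity))
    filter_upwards [hev.prod_mk hev] with m hm x hx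
    refine hεU ?_
    rw [dist_eq_norm]
    have hle : ‖chartDeriv I p k (u m.1) x - chartDeriv I p k (u m.2) x‖ ≤ ε / 3 + ε / 3 := by
      refine ContinuousMultilinearMap.norm_le_of_forall_norm_le_one (by positivity) fun v hv => ?_
      have hmem : partialDeriv ψ (hKp hx) k v ∈ {φ : SmoothFun J N | ∃ ψ' ∈ ({ψ} : Set _),
          ∃ (x : E) (hx : x ∈ K) (v : Fin k → E), (∀ j, ‖v j‖ ≤ 1) ∧
            φ = partialDeriv ψ' (hKp hx) k v} :=
        ⟨ψ, mem_singleton ψ, x, hx, v, hv, rfl⟩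
      rw [sub_apply, hu m.1 p x (hKp hx), hu m.2 p x (hKp hx),
        ← sub_sub_sub_cancel_right _ _ (g (partialDeriv ψ (hKp hx) k v))]
      exact (norm_sub_le _ _).trans (add_le_add (hm.1 _ hmem) (hm.2 _ hmem))
    exact hle.trans_lt (by linarith))
  refine ⟨φ, fun p x hx k v => ?_⟩
  have h1 : Tendsto (fun g' : S => chartDeriv I p k (u g') x) l (𝓝 (chartDeriv I p k φ x)) :=
    (tendsto_nhds_iff.1 hφ p k {x} isCompact_singleton (singleton_subset_iff.2 hx)).tendsto_at
      (mem_singleton x)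
  have h2 : Tendsto (fun g' : S => chartDeriv I p k (u g') x v) l (𝓝 (chartDeriv I p k φ x v)) :=
    ((continuous_eval_const v).tendsto _).comp h1
  have h3 : Tendsto (fun g' : S => (g' : CompactDistribution J N) (partialDeriv ψ hx k v)) l
      (𝓝 (g (partialDeriv ψ hx k v))) :=
    ((continuous_eval_const (partialDeriv ψ hx k v)).tendsto g).comp hlg
  exact tendsto_nhds_unique h2 (h3.congr fun g' => (hu g' p x hx k v).symm)

/-- The smooth function obtained by applying the distribution `g` to the second variable of `ψ`. -/
noncomputable def pairing (ψ : SmoothFun (I.prod J) (M × N)) (g : CompactDistribution J N) :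
    SmoothFun I M :=
  (exists_chartDeriv_eq ψ g).choose

theorem chartDeriv_pairing (ψ : SmoothFun (I.prod J) (M × N)) (g : CompactDistribution J N) {p : M}
    {x : E} (hx : x ∈ (extChartAt I p).target) (k : ℕ) (v : Fin k → E) :
    chartDeriv I p k (pairing ψ g) x v = g (partialDeriv ψ hx k v) :=
  (exists_chartDeriv_eq ψ g).choose_spec p x hx k v

theorem pairing_apply (ψ : SmoothFun (I.prod J) (M × N)) (g : CompactDistribution J N) (x : M) :
    pairing ψ g x = g (SmoothFun.mk (fun y => ψ (x, y)) (contMDiff_prodMk ψ x)) := by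
  have h := chartDeriv_pairing ψ g (mem_extChartAt_target (I := I) x) 0 0
  rw [chartDeriv_zero_apply, extChartAt_to_inv] at h
  rw [h]
  congr 1
  ext y
  change ψ ((extChartAt I x).symm (extChartAt I x x), y) = ψ (x, y)
  rw [extChartAt_to_inv]

theorem chartSeminorm_pairing_le (ψ : SmoothFun (I.prod J) (M × N)) (g : CompactDistribution J N)
    (i : SeminormIndex I M) {C : ℝ} (hC : 0 ≤ C)
    (h : ∀ (x : E) (hx : x ∈ i.1.2.2) (v : Fin i.1.2.1 → E), (∀ j, ‖v j‖ ≤ 1) →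
      ‖g (partialDeriv ψ (i.2.2 hx) i.1.2.1 v)‖ ≤ C) : chartSeminorm i (pairing ψ g) ≤ C :=
  chartSeminorm_le hC fun x hx =>
    ContinuousMultilinearMap.norm_le_of_forall_norm_le_one hC fun v hv => by
      rw [chartDeriv_pairing ψ g (i.2.2 hx)]
      exact h x hx v hv

end SmoothFun

end Pairing

/-! ### Integral operators and convolution -/

section Convolution

open Bornology Filter SmoothFun

variable {E : Type*} [NormedAddCommGroup E] [NormedSpace ℝ E]
  {M : Type*} [TopologicalSpace M] [ChartedSpace E M]

namespace SmoothHypergroup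

theorem IsIntegralOperator.apply_eq {g : CompactDistribution 𝓘(ℝ, E) M}
    {A A' : SmoothFun 𝓘(ℝ, E) M →L[ℂ] SmoothFun 𝓘(ℝ, E) M}
    {𝓗 : SmoothHypergroup (E := E) M} (hA : 𝓗.IsIntegralOperator g A)
    (hA' : 𝓗.IsIntegralOperator g A') (f : CompactDistribution 𝓘(ℝ, E) M)
    (φ : SmoothFun 𝓘(ℝ, E) M) : f (A φ) = f (A' φ) := by
  obtain ⟨u, hu, h⟩ := hA f φ
  obtain ⟨u', hu', h'⟩ := hA' f φ
  have : u = u' := by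
    ext x
    rw [hu, hu']
  rw [h, h', this]

variable (𝓗 : SmoothHypergroup (E := E) M)

/-- The continuous linear operator `φ ↦ ((x, y) ↦ (R y φ) x)` from `C^∞(M)` to `C^∞(M × M)`. -/
noncomputable def translation :
    SmoothFun 𝓘(ℝ, E) M →L[ℂ] SmoothFun (𝓘(ℝ, E).prod 𝓘(ℝ, E)) (M × M) where
  toFun φ := SmoothFun.mk (fun p : M × M => 𝓗.R p.2 φ p.1) (𝓗.contMDiff_uncurry φ)
  map_add' φ φ' := by
    ext p
    change 𝓗.R p.2 (φ + φ') p.1 = 𝓗.R p.2 φ p.1 + 𝓗.R p.2 φ' p.1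
    rw [map_add]
    rfl
  map_smul' c φ := by
    ext p
    change 𝓗.R p.2 (c • φ) p.1 = c * 𝓗.R p.2 φ p.1
    rw [map_smul]
    rfl
  cont := 𝓗.continuous_uncurry

variable [IsManifold 𝓘(ℝ, E) ∞ M]

/-- The derivatives in the first variable, over a compact set of a chart, of the functions
`(x, y) ↦ (R y φ) x` with `φ ∈ B`. -/
noncomputable def translationDeriv (B : Set (SmoothFun 𝓘(ℝ, E) M)) (i : SeminormIndex 𝓘(ℝ, E) M) :
    Set (SmoothFun 𝓘(ℝ, E) M) :=
  {χ | ∃ ψ ∈ 𝓗.translation '' B, ∃ (x : E) (hx : x ∈ i.1.2.2) (v : Fin i.1.2.1 → E),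
    (∀ j, ‖v j‖ ≤ 1) ∧ χ = partialDeriv ψ (i.2.2 hx) i.1.2.1 v}

theorem isVonNBounded_translationDeriv {B : Set (SmoothFun 𝓘(ℝ, E) M)} (hB : IsVonNBounded ℂ B)
    (i : SeminormIndex 𝓘(ℝ, E) M) : IsVonNBounded ℂ (𝓗.translationDeriv B i) :=
  isVonNBounded_partialDeriv (hB.image 𝓗.translation) i

variable [FiniteDimensional ℝ E]

/-- The underlying linear map of the operator `R(g) = ∫ R^x dg(x)`. -/
noncomputable def integralLinearMap (g : CompactDistribution 𝓘(ℝ, E) M) :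
    SmoothFun 𝓘(ℝ, E) M →ₗ[ℂ] SmoothFun 𝓘(ℝ, E) M where
  toFun φ := pairing (𝓗.translation φ) g
  map_add' φ φ' := by
    ext x
    change pairing _ g x = pairing _ g x + pairing _ g x
    simp only [pairing_apply]
    rw [← map_add]
    congr 1
    ext y
    exact DFunLike.congr_fun (map_add 𝓗.translation φ φ') (x, y)
  map_smul' c φ := by
    ext x
    change pairing _ g x = c * pairing _ g x
    simp only [pairing_apply]
    rw [← smul_eq_mul, ← map_smul]
    congr 1
    ext y
    exact DFunLike.congr_fun (map_smul 𝓗.translation c φ) (x, y)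

theorem integralLinearMap_apply (g : CompactDistribution 𝓘(ℝ, E) M) (φ : SmoothFun 𝓘(ℝ, E) M)
    (x : M) :
    𝓗.integralLinearMap g φ x = g (SmoothFun.mk (fun y => 𝓗.R y φ x) (𝓗.contMDiff_left φ x)) :=
  pairing_apply _ _ _

theorem chartSeminorm_integralLinearMap_le {B : Set (SmoothFun 𝓘(ℝ, E) M)}
    {i : SeminormIndex 𝓘(ℝ, E) M} {g : CompactDistribution 𝓘(ℝ, E) M} {C : ℝ} (hC : 0 ≤ C)
    (h : ∀ χ ∈ 𝓗.translationDeriv B i, ‖g χ‖ ≤ C) {φ : SmoothFun 𝓘(ℝ, E) M} (hφ : φ ∈ B) :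
    chartSeminorm i (𝓗.integralLinearMap g φ) ≤ C :=
  chartSeminorm_pairing_le _ g i hC fun x hx v hv =>
    h _ ⟨_, mem_image_of_mem _ hφ, x, hx, v, hv, rfl⟩

variable [SigmaCompactSpace M]

theorem continuous_integralLinearMap (g : CompactDistribution 𝓘(ℝ, E) M) :
    Continuous (𝓗.integralLinearMap g) := by
  have : Nonempty M := ⟨𝓗.e⟩
  obtain ⟨i, hi⟩ := exists_countable_withSeminorms 𝓘(ℝ, E) M
  have := hi.firstCountableTopology
  -- `C^∞(M)` is metrizable, hence bornological: it suffices to preserve bounded sets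
  refine LinearMap.continuous_of_locally_bounded _ fun B hB => ?_
  rw [(withSeminorms_chartSeminorm 𝓘(ℝ, E) M).isVonNBounded_iff_seminorm_bddAbove]
  intro j
  obtain ⟨C, hC, hgC⟩ := g.exists_norm_le_of_isVonNBounded (𝓗.isVonNBounded_translationDeriv hB j)
  refine ⟨C, ?_⟩
  rintro _ ⟨_, ⟨φ, hφ, rfl⟩, rfl⟩
  exact 𝓗.chartSeminorm_integralLinearMap_le hC hgC hφ

/-- The continuous linear operator `R(g) = ∫ R^x dg(x)` on `C^∞(M)`, `(R(g) φ)(x) = ⟨g, L^x φ⟩`. -/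
noncomputable def integralOperator (g : CompactDistribution 𝓘(ℝ, E) M) :
    SmoothFun 𝓘(ℝ, E) M →L[ℂ] SmoothFun 𝓘(ℝ, E) M :=
  ⟨𝓗.integralLinearMap g, 𝓗.continuous_integralLinearMap g⟩

theorem integralOperator_apply (g : CompactDistribution 𝓘(ℝ, E) M) (φ : SmoothFun 𝓘(ℝ, E) M)
    (x : M) :
    𝓗.integralOperator g φ x = g (SmoothFun.mk (fun y => 𝓗.R y φ x) (𝓗.contMDiff_left φ x)) :=
  𝓗.integralLinearMap_apply g φ x

theorem integralOperator_add (g g' : CompactDistribution 𝓘(ℝ, E) M) :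
    𝓗.integralOperator (g + g') = 𝓗.integralOperator g + 𝓗.integralOperator g' := by
  ext φ x
  change 𝓗.integralOperator (g + g') φ x = 𝓗.integralOperator g φ x + 𝓗.integralOperator g' φ x
  simp only [integralOperator_apply]
  rfl

theorem integralOperator_smul (c : ℂ) (g : CompactDistribution 𝓘(ℝ, E) M) :
    𝓗.integralOperator (c • g) = c • 𝓗.integralOperator g := by
  ext φ x
  change 𝓗.integralOperator (c • g) φ x = c * 𝓗.integralOperator g φ x
  simp only [integralOperator_apply]
  rfl

theorem integralOperator_dirac (x : M) (φ : SmoothFun 𝓘(ℝ, E) M) :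
    𝓗.integralOperator (dirac 𝓘(ℝ, E) x) φ = 𝓗.R x φ := by
  ext t
  rw [integralOperator_apply]
  rfl

/-- `g ↦ R(g) φ` as a linear map from `𝒟(M)` to `C^∞(M)`. -/
noncomputable def integralOrbit (φ : SmoothFun 𝓘(ℝ, E) M) :
    CompactDistribution 𝓘(ℝ, E) M →ₗ[ℂ] SmoothFun 𝓘(ℝ, E) M where
  toFun g := 𝓗.integralOperator g φ
  map_add' g g' := by rw [integralOperator_add]; rfl
  map_smul' c g := by rw [integralOperator_smul]; rfl

theorem continuous_integralOrbit (φ : SmoothFun 𝓘(ℝ, E) M) : Continuous (𝓗.integralOrbit φ) := by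
  refine continuous_of_continuousAt_zero _ ?_
  rw [ContinuousAt, map_zero, (withSeminorms_chartSeminorm 𝓘(ℝ, E) M).tendsto_nhds]
  intro i ε hε
  filter_upwards [StrongDual.eventually_norm_sub_le 0
    (𝓗.isVonNBounded_translationDeriv (isVonNBounded_singleton (𝕜 := ℂ) (x := φ)) i)
    (half_pos hε)] with g hg
  rw [sub_zero]
  refine (𝓗.chartSeminorm_integralLinearMap_le (B := {φ}) (half_pos hε).le (fun χ hχ => ?_)
    (mem_singleton φ)).trans_lt (half_lt_self hε)
  simpa using hg χ hχ

/-- The operator `R(g)` is the integral of the translations. For fixed `f` and `φ` the functional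
`g ↦ ⟨f, R(g) φ⟩` is continuous, hence by semireflexivity it is the evaluation at some
`u ∈ C^∞(M)`; the values `u x = ⟨f, R^x φ⟩` are found by inserting Dirac functionals. -/
theorem isIntegralOperator_integralOperator (g : CompactDistribution 𝓘(ℝ, E) M) :
    𝓗.IsIntegralOperator g (𝓗.integralOperator g) := by
  intro f φ
  obtain ⟨u, hu⟩ := (withSeminorms_chartSeminorm 𝓘(ℝ, E) M).exists_eval_eq
    (f.toLinearMap ∘ₗ 𝓗.integralOrbit φ) (f.continuous.comp (𝓗.continuous_integralOrbit φ))
  have hu' : ∀ g, f (𝓗.integralOperator g φ) = g u := hu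
  refine ⟨u, fun x => ?_, hu' g⟩
  rw [← 𝓗.integralOperator_dirac, hu']
  rfl

/-- The generalized convolution `⟨f * g, φ⟩ = ⟨f, R(g) φ⟩`. -/
noncomputable def convolution : CompactDistribution 𝓘(ℝ, E) M →ₗ[ℂ]
    CompactDistribution 𝓘(ℝ, E) M →ₗ[ℂ] CompactDistribution 𝓘(ℝ, E) M :=
  LinearMap.mk₂ ℂ (fun f g => f.comp (𝓗.integralOperator g))
    (fun _ _ _ => rfl) (fun _ _ _ => rfl)
    (fun f g g' => by
      ext φ
      change f (𝓗.integralOperator (g + g') φ) = _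
      rw [integralOperator_add]
      exact map_add f _ _)
    (fun c f g => by
      ext φ
      change f (𝓗.integralOperator (c • g) φ) = _
      rw [integralOperator_smul]
      exact map_smul f _ _)

theorem convolution_apply (f g : CompactDistribution 𝓘(ℝ, E) M) (φ : SmoothFun 𝓘(ℝ, E) M) :
    𝓗.convolution f g φ = f (𝓗.integralOperator g φ) := rfl

theorem isConvolution_convolution : 𝓗.IsConvolution 𝓗.convolution := fun g =>
  ⟨_, 𝓗.isIntegralOperator_integralOperator g, fun _ _ => rfl⟩

/-- `R(h)` commutes with the left translations `L^y`. -/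
theorem integralOperator_left (h : CompactDistribution 𝓘(ℝ, E) M) (φ : SmoothFun 𝓘(ℝ, E) M)
    (y : M) :
    𝓗.integralOperator h (SmoothFun.mk (fun s => 𝓗.R s φ y) (𝓗.contMDiff_left φ y)) =
      SmoothFun.mk (fun t => 𝓗.R t (𝓗.integralOperator h φ) y)
        (𝓗.contMDiff_left (𝓗.integralOperator h φ) y) := by
  ext t
  -- the functional `w ↦ (R^t w) y`
  let f : CompactDistribution 𝓘(ℝ, E) M :=
    (dirac (𝓘(ℝ, E).prod 𝓘(ℝ, E)) (y, t)).comp 𝓗.translation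
  obtain ⟨u, hu, hfu⟩ := 𝓗.isIntegralOperator_integralOperator h f φ
  have h1 : 𝓗.R t (𝓗.integralOperator h φ) y = h u := hfu
  change _ = 𝓗.R t (𝓗.integralOperator h φ) y
  rw [h1, integralOperator_apply]
  congr 1
  ext s
  rw [hu]
  exact 𝓗.assoc s y φ t

theorem convolution_assoc (f g h : CompactDistribution 𝓘(ℝ, E) M) :
    𝓗.convolution (𝓗.convolution f g) h = 𝓗.convolution f (𝓗.convolution g h) := by
  ext φ
  simp only [convolution_apply]
  congr 1
  ext x
  rw [integralOperator_apply, integralOperator_apply, convolution_apply, integralOperator_left]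

theorem convolution_dirac_e (f : CompactDistribution 𝓘(ℝ, E) M) :
    𝓗.convolution f (dirac 𝓘(ℝ, E) 𝓗.e) = f := by
  ext φ
  rw [convolution_apply, integralOperator_dirac, 𝓗.R_e]
  rfl

/-- For bounded `B` there is a bounded `W` such that the functions `R(g) φ`, with `φ ∈ B` and `g` in
the polar of `W`, form a bounded set. Each of countably many seminorms of `R(g) φ` is controlled by
`g` on a bounded set, and Mackey's countability condition absorbs these sets in a single one. -/
theorem exists_isVonNBounded_integralOperator {B : Set (SmoothFun 𝓘(ℝ, E) M)}
    (hB : IsVonNBounded ℂ B) : ∃ W : Set (SmoothFun 𝓘(ℝ, E) M), IsVonNBounded ℂ W ∧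
      IsVonNBounded ℂ {χ | ∃ φ ∈ B, ∃ g : CompactDistribution 𝓘(ℝ, E) M,
        (∀ w ∈ W, ‖g w‖ ≤ 1) ∧ χ = 𝓗.integralOperator g φ} := by
  have : Nonempty M := ⟨𝓗.e⟩
  obtain ⟨i, hi⟩ := exists_countable_withSeminorms 𝓘(ℝ, E) M
  obtain ⟨c, hc, hW⟩ := hi.exists_bounded_iUnion_smul fun n =>
    𝓗.isVonNBounded_translationDeriv hB (i n)
  refine ⟨_, hW, hi.isVonNBounded_iff_seminorm_bddAbove.2 fun n => ⟨(c n)⁻¹, ?_⟩⟩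
  rintro _ ⟨_, ⟨φ, hφ, g, hg, rfl⟩, rfl⟩
  refine 𝓗.chartSeminorm_integralLinearMap_le (inv_nonneg.2 (hc n).le) (fun χ hχ => ?_) hφ
  have h1 := hg _ (mem_iUnion.2 ⟨n, mem_image_of_mem _ hχ⟩)
  rw [map_smul, norm_smul, Complex.norm_real, Real.norm_of_nonneg (hc n).le] at h1
  rwa [← one_div, le_div_iff₀' (hc n)]

theorem continuous_convolution : Continuous fun p : CompactDistribution 𝓘(ℝ, E) M ×
    CompactDistribution 𝓘(ℝ, E) M => 𝓗.convolution p.1 p.2 := by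
  have hbasis := StrongDual.hasBasis_nhds_zero_polar (V := SmoothFun 𝓘(ℝ, E) M)
  -- polars of bounded sets `S` and `W` whose product is mapped into the polar of `B`
  have key : ∀ B : Set (SmoothFun 𝓘(ℝ, E) M), IsVonNBounded ℂ B →
      ∃ S W : Set (SmoothFun 𝓘(ℝ, E) M), IsVonNBounded ℂ S ∧ IsVonNBounded ℂ W ∧
        ∀ (f g : CompactDistribution 𝓘(ℝ, E) M) (C : ℝ), (∀ s ∈ S, ‖f s‖ ≤ C) →
          (∀ w ∈ W, ‖g w‖ ≤ 1) → ∀ φ ∈ B, ‖𝓗.convolution f g φ‖ ≤ C := fun B hB => by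
    obtain ⟨W, hW, hS⟩ := 𝓗.exists_isVonNBounded_integralOperator hB
    exact ⟨_, W, hS, hW, fun f g C hf hg φ hφ => hf _ ⟨φ, hφ, g, hg, rfl⟩⟩
  have hpolar : ∀ {S : Set (SmoothFun 𝓘(ℝ, E) M)}, IsVonNBounded ℂ S →
      ∀ᶠ f in 𝓝 (0 : CompactDistribution 𝓘(ℝ, E) M), ∀ s ∈ S, ‖f s‖ ≤ 1 := fun hS =>
    hbasis.mem_of_mem hS
  refine continuous_of_continuousAt_zero₂
    (LinearMap.toAddMonoidHom'.comp 𝓗.convolution.toAddMonoidHom) ?_ ?_ ?_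
  · change Tendsto (fun p : CompactDistribution 𝓘(ℝ, E) M × CompactDistribution 𝓘(ℝ, E) M =>
      𝓗.convolution p.1 p.2) (𝓝 (0, 0)) (𝓝 (𝓗.convolution 0 0))
    rw [map_zero, hbasis.tendsto_right_iff, nhds_prod_eq]
    intro B hB
    obtain ⟨S, W, hS, hW, h⟩ := key B hB
    filter_upwards [(hpolar hS).prod_mk (hpolar hW)] with p hp φ hφ
    exact h p.1 p.2 1 hp.1 hp.2 φ hφ
  · intro f
    change Tendsto (fun g => 𝓗.convolution f g) (𝓝 0) (𝓝 (𝓗.convolution f 0))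
    rw [map_zero, hbasis.tendsto_right_iff]
    intro B hB
    obtain ⟨S, W, hS, hW, h⟩ := key B hB
    obtain ⟨C, hC, hfC⟩ := f.exists_norm_le_of_isVonNBounded hS
    -- `f` is bounded on `S`, so `W` has to be enlarged by that bound
    have hW' := hW.image (((C + 1 : ℝ) : ℂ) • ContinuousLinearMap.id ℂ (SmoothFun 𝓘(ℝ, E) M))
    filter_upwards [hpolar hW'] with g hg φ hφ
    have h1 := h f (((C + 1 : ℝ) : ℂ) • g) C hfC (fun w hw => by
      have := hg _ (mem_image_of_mem _ hw)
      rw [_root_.smul_apply, map_smul] at this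
      exact this) φ hφ
    rw [map_smul, _root_.smul_apply, norm_smul, Complex.norm_real,
      Real.norm_of_nonneg (by positivity)] at h1
    have h2 : 0 ≤ ‖𝓗.convolution f g φ‖ := norm_nonneg _
    nlinarith
  · intro g
    change Tendsto (fun f => 𝓗.convolution f g) (𝓝 0) (𝓝 (𝓗.convolution 0 g))
    rw [map_zero, LinearMap.zero_apply, hbasis.tendsto_right_iff]
    intro B hB
    filter_upwards [hpolar (hB.image (𝓗.integralOperator g))] with f hf φ hφ
    exact hf _ (mem_image_of_mem _ hφ)

end SmoothHypergroup

end Convolution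

theorem theorem1 {E : Type*} [NormedAddCommGroup E] [NormedSpace ℝ E] [FiniteDimensional ℝ E]
    {M : Type*} [TopologicalSpace M] [T2Space M] [SigmaCompactSpace M]
    [ChartedSpace E M] [IsManifold 𝓘(ℝ, E) ∞ M]
    (𝓗 : SmoothHypergroup (E := E) M) :
    -- the (strong) topology of `𝒟(M)` is the Mackey topology; in particular it is locally convex
    IsMackeyTopology
      (inferInstance : TopologicalSpace (CompactDistribution 𝓘(ℝ, E) M)) ∧
    -- the generalized convolution is well defined and makes `𝒟(M)` an algebra
    ∃! conv : CompactDistribution 𝓘(ℝ, E) M →ₗ[ℂ]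
        CompactDistribution 𝓘(ℝ, E) M →ₗ[ℂ] CompactDistribution 𝓘(ℝ, E) M,
      𝓗.IsConvolution conv ∧
      -- associativity
      (∀ f g h, conv (conv f g) h = conv f (conv g h)) ∧
      -- joint continuity
      (Continuous fun p : CompactDistribution 𝓘(ℝ, E) M × CompactDistribution 𝓘(ℝ, E) M =>
        conv p.1 p.2) ∧
      -- the evaluation at the neutral element is a multiplicative right identity
      ∃ ε : CompactDistribution 𝓘(ℝ, E) M,
        (∀ φ, ε φ = φ 𝓗.e) ∧
        (∀ φ ψ, ε (φ * ψ) = ε φ * ε ψ) ∧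
        ∀ f, conv f ε = f := by
  refine ⟨(SmoothFun.withSeminorms_chartSeminorm 𝓘(ℝ, E) M).isMackeyTopology_strong,
    𝓗.convolution, ⟨𝓗.isConvolution_convolution, 𝓗.convolution_assoc, 𝓗.continuous_convolution,
      SmoothFun.dirac 𝓘(ℝ, E) 𝓗.e, fun _ => rfl, fun _ _ => rfl, 𝓗.convolution_dirac_e⟩, ?_⟩
  rintro conv ⟨hconv, -⟩
  ext f g φ
  obtain ⟨A, hA, hfA⟩ := hconv g
  rw [hfA, 𝓗.convolution_apply]
  exact hA.apply_eq (𝓗.isIntegralOperator_integralOperator g) f φ
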